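/- Let $k$ be an algebraically closed field of arbitrary characteristic and let $R=k\{X_1,\dots,X_s\}/\langle \mathcal F\rangle$ be the quotient of the free associative $k$-algebra on finitely many generators by the two-sided ideal generated by a (possibly infinite) set $\mathcal F$ of relations. Assume that $R$ satisfies a monic polynomial identity. Let $d$ be a positive integer such that every irreducible representation of $R$ has $k$-dimension at most $d$, and let $N$ be a positive common multiple of $1,2,\dots,d$. Let $\widehat C=k[x^{(\ell)}_{ij}: 1\le i,j\le N,\ 1\le \ell\le s]$, let $C$ be the quotient of $\widehat C$ by the ideal generated by the entries of the matrices obtained from the relations $f\in\mathcal F$ by substituting the generic matrices $(x^{(\ell)}_{ij})$ for the $X_\ell$, and let $M=M_N(C)$. Let $\pi:R\to M$ be the $k$-algebra homomorphism sending $X_\ell$ to the image of the $\ell$-th generic matrix, and let $T\subseteq C$ be the $k$-subalgebra generated by the coefficients of the characteristic polynomials of the elements of $\pi(R)$; identify $C$ with the scalar matrices in $M$. Every representation $\rho: R\to M_N(k)$ induces a homomorphism $\widetilde\rho|_C: C\to k$, sending the image of $x^{(\ell)}_{ij}$ to $\rho(X_\ell)_{ij}$. Let $\operatorname{Prim}R$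 be the set of (left) primitive ideals of $R$ and $\operatorname{Max}T$ the set of maximal ideals of $T$, with the Jacobson/Zariski topologies: the closed sets are $V_R(I)=\{P\in\operatorname{Prim}R: P\supseteq I\}$ and $V_T(J)=\{\mathfrak m\in\operatorname{Max}T:\mathfrak m\supseteq J\}$, for ideals $I$ of $R$ and $J$ of $T$. Let $W_R(I)$ and $W_T(J)$ denote their complements. For $P\in\operatorname{Prim}R$ choose an irreducible representation $\rho:R\to M_m(k)$ with kernel $P$ (so $1\le m\le d$), let $\rho_N:R\to M_N(k)$ be the block diagonal representation with $N/m$ diagonal blocks equal to $\rho$, let $\gamma_{N,P}=\widetilde{\rho_N}|_T:T\to k$, and put $\Psi(P)=\ker\gamma_{N,P}\in \operatorname{Max}T$. **Proposition.** $\Psi(P)$ does not depend on the choice of $\rho$, and $\Psi:\operatorname{Prim}R\to\operatorname{Max}T$ is injective, and open and closed onto its image. Precisely, for every ideal $I$ of $R$, $$\Psi(V_R(I))=\operatorname{Image}\Psi\cap V_T(J),\qquad \Psi(W_R(I))=\operatorname{Image}\Psi\cap W_T(J),\qquad\text{where } J=(M\pi(I)M)\cap T.$$ Moreover, $T$ is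 a finitely generated $k$-algebra, and for every finite system of generators $t_1,\dots,t_q$ of $T$ the map $$\operatorname{Prim}R\to k^q,\qquad P\mapsto(\gamma_{N,P}(t_1),\dots,\gamma_{N,P}(t_q)),$$ which is $\Psi$ followed by the corresponding embedding of $\operatorname{Max}T$ in $k^q$, is injective, is closed onto its image, and has as image a constructible subset of $k^q$ (with the Zariski topology). -/

import Mathlib

namespace AffinePI

universe u

/-! ### Primitive ideals and the Jacobson/Zariski topology -/

section Primitive

variable {R : Type u} [Ring R]

/-- A two-sided ideal is (left) primitive if it is the annihilator of a simple left module.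
(Simple modules are quotients of `R`, so modules in the universe of `R` suffice.) -/
def IsPrimitiveIdeal (P : TwoSidedIdeal R) : Prop :=
  ∃ (V : Type u) (_ : AddCommGroup V) (_ : Module R V),
    IsSimpleModule R V ∧ ∀ r : R, r ∈ P ↔ ∀ v : V, r • v = 0

variable (R) in
/-- The set of (left) primitive ideals of `R`. -/
def Prim : Type u := {P : TwoSidedIdeal R // IsPrimitiveIdeal P}

/-- The underlying two-sided ideal of a point of `Prim R`. -/
def Prim.ideal (P : Prim R) : TwoSidedIdeal R := P.1

/-- `V_R(I)`: the primitive ideals containing `I`. -/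
def primHull (I : TwoSidedIdeal R) : Set (Prim R) := {P | I ≤ P.ideal}

theorem Prim.ne_top (P : Prim R) : ¬ (⊤ : TwoSidedIdeal R) ≤ P.ideal := by
  obtain ⟨P, V, _, _, hV, hP⟩ := P
  intro h
  have : Nontrivial V := IsSimpleModule.nontrivial R V
  obtain ⟨v, hv⟩ := exists_ne (0 : V)
  exact hv (by simpa using (hP 1).1 (h (TwoSidedIdeal.mem_top R)) v)

theorem Prim.inf_le (P : Prim R) {I J : TwoSidedIdeal R} (h : I ⊓ J ≤ P.ideal) :
    I ≤ P.ideal ∨ J ≤ P.ideal := by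
  obtain ⟨P, V, _, _, hV, hP⟩ := P
  by_contra! hc
  obtain ⟨h1, h2⟩ := hc
  obtain ⟨a, haI, haP⟩ := Set.not_subset.1 h1
  obtain ⟨b, hbJ, hbP⟩ := Set.not_subset.1 h2
  change a ∉ P at haP
  change b ∉ P at hbP
  rw [hP] at haP hbP
  push Not at haP hbP
  obtain ⟨v, hv⟩ := haP
  obtain ⟨w, hw⟩ := hbP
  have htop := (IsSimpleModule.span_singleton_eq_top R hw)
  have : v ∈ Submodule.span R {b • w} := by rw [htop]; trivial
  obtain ⟨r, hr⟩ := Submodule.mem_span_singleton.1 this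
  have hmem : a * (r * b) ∈ I ⊓ J :=
    (TwoSidedIdeal.mem_inf R).2 ⟨I.mul_mem_right _ _ haI,
      J.mul_mem_left _ _ (J.mul_mem_left _ _ hbJ)⟩
  have := (hP _).1 (h hmem) w
  rw [mul_smul, mul_smul, hr] at this
  exact hv this

/-- The Jacobson/Zariski topology: the closed sets are the sets `V_R(I)`. -/
instance : TopologicalSpace (Prim R) :=
  TopologicalSpace.ofClosed (Set.range primHull)
    ⟨⊤, Set.eq_empty_of_forall_notMem fun P => P.ne_top⟩
    (by
      intro A hA
      refine ⟨sSup {I | primHull I ∈ A}, Set.ext fun P => ?_⟩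
      simp only [primHull, Set.mem_ofPred_eq, sSup_le_iff, Set.mem_sInter]
      constructor
      · intro h t ht
        obtain ⟨I, rfl⟩ := hA ht
        exact h I ht
      · intro h I hI
        exact h _ hI)
    (by
      rintro _ ⟨I, rfl⟩ _ ⟨J, rfl⟩
      refine ⟨I ⊓ J, Set.ext fun P => ⟨fun h => P.inf_le h, ?_⟩⟩
      rintro (h | h)
      · exact le_trans (inf_le_left : I ⊓ J ≤ I) h
      · exact le_trans (inf_le_right : I ⊓ J ≤ J) h)

theorem isClosed_prim_iff {Z : Set (Prim R)} : IsClosed Z ↔ ∃ I, primHull I = Z := by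
  rw [← isOpen_compl_iff]
  change Zᶜᶜ ∈ Set.range primHull ↔ _
  rw [compl_compl]
  rfl

end Primitive

/-! ### Maximal ideals, and affine space with its Zariski topology -/

/-- `V_T(J)`: the maximal ideals containing `J`. -/
def maxHull {T : Type u} [CommRing T] (J : Ideal T) : Set (MaximalSpectrum T) :=
  {m | J ≤ m.asIdeal}

/-- The affine space `k^q`, to be equipped with its Zariski topology. -/
def AffineSpc (k : Type u) (q : ℕ) : Type u := Fin q → k

/-- The common zero set in `k^q` of a set of polynomials. -/
def zeros {k : Type u} [Field k] {q : ℕ} (S : Set (MvPolynomial (Fin q) k)) :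
    Set (AffineSpc k q) :=
  {x | ∀ f ∈ S, MvPolynomial.eval (x : Fin q → k) f = 0}

/-- The Zariski topology: the closed sets are the common zero sets of sets of polynomials. -/
instance {k : Type u} [Field k] {q : ℕ} : TopologicalSpace (AffineSpc k q) :=
  TopologicalSpace.ofClosed (Set.range zeros)
    ⟨{1}, Set.eq_empty_of_forall_notMem fun x hx => by simpa using hx 1 rfl⟩
    (by
      intro A hA
      refine ⟨⋃₀ {S | zeros S ∈ A}, Set.ext fun x => ?_⟩
      constructor
      · intro h t ht
        obtain ⟨S, rfl⟩ := hA ht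
        exact fun f hf => h f ⟨S, ht, hf⟩
      · rintro h f ⟨S, hS, hf⟩
        exact h _ hS f hf)
    (by
      rintro _ ⟨S, rfl⟩ _ ⟨S', rfl⟩
      refine ⟨{h | ∃ f ∈ S, ∃ g ∈ S', h = f * g}, Set.ext fun x => ⟨fun h => ?_, ?_⟩⟩
      · by_contra! hc
        obtain ⟨h1, h2⟩ := not_or.1 hc
        simp only [zeros, Set.mem_ofPred_eq, not_forall] at h1 h2
        obtain ⟨f, hf, hfx⟩ := h1
        obtain ⟨g, hg, hgx⟩ := h2
        have := h (f * g) ⟨f, hf, g, hg, rfl⟩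
        rw [map_mul] at this
        exact (mul_ne_zero hfx hgx) this
      · rintro (h | h) _ ⟨f, hf, g, hg, rfl⟩
        · rw [map_mul, h f hf, zero_mul]
        · rw [map_mul, h g hg, mul_zero])

/-! ### Algebras with a polynomial identity, and their irreducible representations -/

section Reps

variable (k : Type u) [Field k]

/-- `R` satisfies a polynomial identity. Over a field every nonzero identity is a scalar multiple
of a monic one. -/
def SatisfiesPI (R : Type u) [Ring R] [Algebra k R] : Prop :=
  ∃ f : FreeAlgebra k ℕ, f ≠ 0 ∧ ∀ x : ℕ → R, FreeAlgebra.lift k x f = 0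

/-- Every irreducible representation of `R` has `k`-dimension no greater than `d`. -/
def IrrepDimLE (R : Type u) [Ring R] [Algebra k R] (d : ℕ) : Prop :=
  ∀ (V : Type u) [AddCommGroup V] [Module k V] [Module R V] [IsScalarTower k R V],
    IsSimpleModule R V → Module.rank k V ≤ (d : Cardinal.{u})

variable {k}

/-- A representation `R → M_m(k)` is irreducible if `k^m` is nonzero and has no invariant
subspaces other than `0` and `k^m`. -/
def IsIrreducibleRep {R : Type u} [Ring R] [Algebra k R] {m : ℕ}
    (ρ : R →ₐ[k] Matrix (Fin m) (Fin m) k) : Prop :=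
  0 < m ∧ ∀ W : Submodule k (Fin m → k),
    (∀ r : R, ∀ w ∈ W, (ρ r).mulVec w ∈ W) → W = ⊥ ∨ W = ⊤

/-- A primitive ideal is the kernel of an irreducible matrix representation, as soon as the
irreducible representations have bounded dimension. -/
theorem exists_irreducibleRep {R : Type u} [Ring R] [Algebra k R] {d : ℕ}
    (h : IrrepDimLE k R d) (P : Prim R) :
    ∃ (m : ℕ) (ρ : R →ₐ[k] Matrix (Fin m) (Fin m) k),
      (1 ≤ m ∧ m ≤ d) ∧ IsIrreducibleRep ρ ∧ TwoSidedIdeal.ker ρ = P.ideal := by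
  obtain ⟨P, V, _, _, hV, hP⟩ := P
  let _ : Module k V := Module.compHom V (algebraMap k R)
  have : IsScalarTower k R V := ⟨fun a r v => by
    change (a • r) • v = algebraMap k R a • r • v
    rw [Algebra.smul_def, mul_smul]⟩
  have hrank := h V hV
  have : Module.Finite k V :=
    Module.rank_lt_aleph0_iff.1 (hrank.trans_lt (Cardinal.natCast_lt_aleph0))
  have hfin : Module.finrank k V ≤ d := Module.finrank_le_of_rank_le hrank
  have : Nontrivial V := IsSimpleModule.nontrivial R V
  have hpos : 0 < Module.finrank k V := Module.finrank_pos
  let b := Module.finBasis k V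
  let ρ : R →ₐ[k] Matrix (Fin (Module.finrank k V)) (Fin (Module.finrank k V)) k :=
    (LinearMap.toMatrixAlgEquiv b).toAlgHom.comp (Algebra.lsmul k k V)
  have hρ : ∀ r v, (ρ r).mulVec (b.repr v) = b.repr (r • v) := fun r v => by
    exact LinearMap.toMatrix_mulVec_repr b b (Algebra.lsmul k k V r) v
  refine ⟨_, ρ, ⟨hpos, hfin⟩, ⟨hpos, fun W hW => ?_⟩, ?_⟩
  · let W' : Submodule R V :=
      { carrier := {v | b.equivFun v ∈ W}
        add_mem' := fun {x y} hx hy => by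
          simp only [Set.mem_ofPred_eq, map_add] at *
          exact W.add_mem hx hy
        zero_mem' := by simp
        smul_mem' := fun r v hv => by
          have := hW r _ hv
          have h2 := hρ r v
          simp only [Set.mem_ofPred_eq, Module.Basis.equivFun_apply] at *
          rwa [h2] at this }
    have hmem : ∀ v, v ∈ W' ↔ b.equivFun v ∈ W := fun v => Iff.rfl
    rcases eq_bot_or_eq_top W' with h0 | h1
    · left
      rw [eq_bot_iff]
      intro w hw
      have : b.equivFun.symm w ∈ W' := by
        rw [hmem, LinearEquiv.apply_symm_apply]; exact hw
      rw [h0, Submodule.mem_bot, LinearEquiv.map_eq_zero_iff] at this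
      exact this
    · right
      rw [eq_top_iff]
      intro w _
      have : b.equivFun.symm w ∈ W' := by rw [h1]; trivial
      rwa [hmem, LinearEquiv.apply_symm_apply] at this
  · refine TwoSidedIdeal.ext fun r => ?_
    rw [TwoSidedIdeal.mem_ker]
    refine Iff.trans ?_ (hP r).symm
    have : ρ r = 0 ↔ Algebra.lsmul k k V r = 0 :=
      map_eq_zero_iff (LinearMap.toMatrixAlgEquiv b) (LinearMap.toMatrixAlgEquiv b).injective
    rw [this, LinearMap.ext_iff]
    rfl

/-- `ρ_N`: the `N`-dimensional block diagonal representation with `N / m` consecutive diagonal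
blocks, all equal to `ρ`. -/
def diagRep {R : Type u} [Ring R] [Algebra k R] {m N : ℕ} (hm : m ∣ N)
    (ρ : R →ₐ[k] Matrix (Fin m) (Fin m) k) : R →ₐ[k] Matrix (Fin N) (Fin N) k :=
  let e : Fin m × Fin (N / m) ≃ Fin N :=
    (Equiv.prodComm _ _).trans (finProdFinEquiv.trans (finCongr (Nat.div_mul_cancel hm)))
  { toFun := fun r => Matrix.reindex e e (Matrix.blockDiagonal fun _ => ρ r)
    map_one' := by
      have : (fun _ : Fin (N / m) => ρ (1 : R)) = 1 := funext fun _ => map_one ρ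
      rw [this, Matrix.blockDiagonal_one]
      simp
    map_mul' := fun a b => by
      have : (fun _ : Fin (N / m) => ρ (a * b)) = fun _ => ρ a * ρ b :=
        funext fun _ => map_mul ρ a b
      rw [this, Matrix.blockDiagonal_mul]
      simp
    map_zero' := by
      have : (fun _ : Fin (N / m) => ρ (0 : R)) = 0 := funext fun _ => map_zero ρ
      rw [this, Matrix.blockDiagonal_zero]
      simp
    map_add' := fun a b => by
      have : (fun _ : Fin (N / m) => ρ (a + b)) = (fun _ => ρ a) + fun _ => ρ b :=
        funext fun _ => map_add ρ a b
      rw [this, Matrix.blockDiagonal_add]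
      rfl
    commutes' := fun c => by
      ext i j
      rw [AlgHom.commutes]
      simp only [Matrix.reindex_apply, Matrix.submatrix_apply, Matrix.blockDiagonal_apply,
        Matrix.algebraMap_matrix_apply]
      have h : i = j ↔ (e.symm i).2 = (e.symm j).2 ∧ (e.symm i).1 = (e.symm j).1 := by
        rw [← e.symm.injective.eq_iff, Prod.ext_iff, and_comm]
      simp only [h, ite_and] }

/-- The entries of `ρ_N` (indices counted from `0`). -/
theorem diagRep_apply {R : Type u} [Ring R] [Algebra k R] {m N : ℕ} (hm : m ∣ N) (hm0 : 0 < m)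
    (ρ : R →ₐ[k] Matrix (Fin m) (Fin m) k) (r : R) (i j : Fin N) :
    diagRep hm ρ r i j = if (i : ℕ) / m = (j : ℕ) / m then
      ρ r ⟨i % m, Nat.mod_lt _ hm0⟩ ⟨j % m, Nat.mod_lt _ hm0⟩ else 0 := by
  simp [diagRep, Matrix.blockDiagonal_apply, Fin.ext_iff]
  rfl

end Reps

/-! ### The algebra `R`, generic matrices, and the trace ring `T` -/

section Generic

variable {k : Type u} [Field k] {s : ℕ}

/-- `R = k{X_1, …, X_s} / ⟨rels⟩`. -/
abbrev Alg (rels : Set (FreeAlgebra k (Fin s))) : Type u :=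
  RingQuot (fun a b : FreeAlgebra k (Fin s) => a ∈ rels ∧ b = 0)

/-- The canonical projection from the free algebra onto `R`. -/
noncomputable def proj (rels : Set (FreeAlgebra k (Fin s))) :
    FreeAlgebra k (Fin s) →ₐ[k] Alg rels :=
  RingQuot.mkAlgHom k _

/-- The `ℓ`-th generic `n × n` matrix, over the polynomial ring in the variables `x_{ij}^{(ℓ)}`. -/
noncomputable def genericMatrix (k : Type u) [Field k] {s : ℕ} (n : ℕ) (l : Fin s) :
    Matrix (Fin n) (Fin n) (MvPolynomial (Fin s × Fin n × Fin n) k) :=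
  Matrix.of fun i j => MvPolynomial.X (l, i, j)

/-- The homomorphism from the free algebra sending the generators to the generic matrices. -/
noncomputable def piHat (k : Type u) [Field k] (s n : ℕ) : FreeAlgebra k (Fin s) →ₐ[k]
    Matrix (Fin n) (Fin n) (MvPolynomial (Fin s × Fin n × Fin n) k) :=
  FreeAlgebra.lift k (genericMatrix k n)

variable (rels : Set (FreeAlgebra k (Fin s))) (n : ℕ)

/-- The ideal generated by the entries of the images of the relations. -/
noncomputable def relIdeal : Ideal (MvPolynomial (Fin s × Fin n × Fin n) k) :=
  Ideal.span {c | ∃ f ∈ rels, ∃ i j, c = piHat k s n f i j}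

/-- The ring `C_n`. -/
abbrev CRing : Type u := MvPolynomial (Fin s × Fin n × Fin n) k ⧸ relIdeal rels n

/-- The ring `M_n = M_n(C_n)`. -/
abbrev MRing : Type u := Matrix (Fin n) (Fin n) (CRing rels n)

/-- `π_n : R → M_n`, sending `X_ℓ` to the image of the `ℓ`-th generic matrix. -/
noncomputable def piHom : Alg rels →ₐ[k] MRing rels n :=
  RingQuot.liftAlgHom k
    ⟨((Ideal.Quotient.mkₐ k (relIdeal rels n)).mapMatrix).comp (piHat k s n), by
      rintro f _ ⟨hf, rfl⟩
      rw [map_zero]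
      ext i j
      exact Ideal.Quotient.eq_zero_iff_mem.2 (Ideal.subset_span ⟨f, hf, i, j, rfl⟩)⟩

/-- `T_n`: the `k`-subalgebra of `C_n` generated by the coefficients of the characteristic
polynomials of the elements of `π_n(R)`. -/
noncomputable def traceRing : Subalgebra k (CRing rels n) :=
  Algebra.adjoin k {c | ∃ (r : Alg rels) (i : ℕ), c = (piHom rels n r).charpoly.coeff i}

/-- The inclusion of `T_n` in `M_n` as scalar matrices. -/
noncomputable def traceRingToM : traceRing rels n →+* MRing rels n :=
  (Matrix.scalar (Fin n)).comp (traceRing rels n).val.toRingHom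

/-- `(M_n π_n(I) M_n) ∩ T_n`, where `M_n π_n(I) M_n` is the two-sided ideal of `M_n` generated
by `π_n(I)`. -/
noncomputable def contraction (I : TwoSidedIdeal (Alg rels)) : Ideal (traceRing rels n) :=
  (TwoSidedIdeal.comap (traceRingToM rels n)
    (TwoSidedIdeal.span (piHom rels n '' (I : Set (Alg rels))))).asIdeal

variable {rels n}

theorem eval_piHat (ρ : Alg rels →ₐ[k] Matrix (Fin n) (Fin n) k) (f : FreeAlgebra k (Fin s)) :
    (MvPolynomial.aeval fun p : Fin s × Fin n × Fin n =>
      ρ (proj rels (FreeAlgebra.ι k p.1)) p.2.1 p.2.2).mapMatrix (piHat k s n f) =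
        ρ (proj rels f) := by
  have : ((MvPolynomial.aeval fun p : Fin s × Fin n × Fin n =>
      ρ (proj rels (FreeAlgebra.ι k p.1)) p.2.1 p.2.2).mapMatrix).comp (piHat k s n) =
        ρ.comp (proj rels) := by
    apply FreeAlgebra.hom_ext
    funext l
    ext i j
    simp [piHat, genericMatrix]
  exact DFunLike.congr_fun this f

/-- The restriction of `ρ̃` to `C_n`: the homomorphism `C_n → k` sending `x_{ij}^{(ℓ)}` to the
`ij`-th entry of `ρ(X_ℓ)`. -/
noncomputable def tildeC (ρ : Alg rels →ₐ[k] Matrix (Fin n) (Fin n) k) : CRing rels n →ₐ[k] k :=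
  Ideal.Quotient.liftₐ (relIdeal rels n)
    (MvPolynomial.aeval fun p : Fin s × Fin n × Fin n =>
      ρ (proj rels (FreeAlgebra.ι k p.1)) p.2.1 p.2.2) (by
    intro a ha
    have hle : relIdeal rels n ≤ RingHom.ker (MvPolynomial.aeval
        fun p : Fin s × Fin n × Fin n =>
          ρ (proj rels (FreeAlgebra.ι k p.1)) p.2.1 p.2.2 :
            MvPolynomial (Fin s × Fin n × Fin n) k →ₐ[k] k) := by
      refine Ideal.span_le.2 ?_
      rintro _ ⟨f, hf, i, j, rfl⟩
      have h0 : proj rels f = 0 := by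
        have := RingQuot.mkAlgHom_rel k
          (s := fun a b : FreeAlgebra k (Fin s) => a ∈ rels ∧ b = 0) ⟨hf, rfl⟩
        rwa [map_zero] at this
      have h1 := congrFun (congrFun (eval_piHat ρ f) i) j
      rw [h0, map_zero] at h1
      exact h1
    exact hle ha)

/-- `ρ̃ : M_n → M_n(k)`, the matrix unital homomorphism induced by `ρ`. -/
noncomputable def tilde (ρ : Alg rels →ₐ[k] Matrix (Fin n) (Fin n) k) :
    MRing rels n →ₐ[k] Matrix (Fin n) (Fin n) k :=
  (tildeC ρ).mapMatrix

/-- `ρ̃ ∘ π_n = ρ`. -/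
theorem tilde_piHom (ρ : Alg rels →ₐ[k] Matrix (Fin n) (Fin n) k) (r : Alg rels) :
    tilde ρ (piHom rels n r) = ρ r := by
  obtain ⟨f, rfl⟩ := RingQuot.mkAlgHom_surjective k _ r
  rw [piHom, RingQuot.liftAlgHom_mkAlgHom_apply]
  exact eval_piHat ρ f

/-- The restriction of `ρ̃` to `T_n`. -/
noncomputable def tildeT (ρ : Alg rels →ₐ[k] Matrix (Fin n) (Fin n) k) :
    traceRing rels n →ₐ[k] k :=
  (tildeC ρ).comp (traceRing rels n).val

end Generic

/-! ### The map `Ψ` -/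

section Psi

variable {k : Type u} [Field k] {s : ℕ} (rels : Set (FreeAlgebra k (Fin s))) {d N : ℕ}

/-- `γ_{N,P} : T → k`, the restriction to `T = T_N` of the homomorphism induced by `ρ_N`, where
`ρ` is an irreducible matrix representation (chosen arbitrarily) with kernel `P`. -/
noncomputable def gammaN (hirr : IrrepDimLE k (Alg rels) d)
    (hdvd : ∀ m, 1 ≤ m → m ≤ d → m ∣ N) (P : Prim (Alg rels)) : traceRing rels N →ₐ[k] k :=
  let hρ := (exists_irreducibleRep hirr P).choose_spec.choose_spec
  tildeT (diagRep (hdvd _ hρ.1.1 hρ.1.2) (exists_irreducibleRep hirr P).choose_spec.choose)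

/-- `Ψ : Prim R → Max T`, `P ↦ ker γ_{N,P}`. -/
noncomputable def Psi (hirr : IrrepDimLE k (Alg rels) d)
    (hdvd : ∀ m, 1 ≤ m → m ≤ d → m ∣ N) (P : Prim (Alg rels)) :
    MaximalSpectrum (traceRing rels N) :=
  ⟨RingHom.ker (gammaN rels hirr hdvd P),
    RingHom.ker_isMaximal_of_surjective _ fun c =>
      ⟨algebraMap k _ c, (gammaN rels hirr hdvd P).commutes c⟩⟩

/-- The map `Prim R → k^q` whose coordinates are `P ↦ γ_{N,P}(t_i)`. When `t` generates `T`, this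
is `Ψ` followed by the closed embedding of `Max T` in `k^q` given by the generators `t`. -/
noncomputable def coordMap (hirr : IrrepDimLE k (Alg rels) d)
    (hdvd : ∀ m, 1 ≤ m → m ≤ d → m ∣ N) {q : ℕ} (t : Fin q → traceRing rels N)
    (P : Prim (Alg rels)) : AffineSpc k q :=
  fun i => gammaN rels hirr hdvd P (t i)

end Psi

end AffinePI

open AffinePI

/-!
The map `Ψ` is controlled by characteristic polynomials. If `ρ` is an irreducible representation
with kernel `P`, then `γ_{N,P}` sends a coefficient of the characteristic polynomial of `π(r)` to
the same coefficient for `ρ_N(r)`. Irreducible representations with the same kernel are equivalent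
(`IsIrreducibleRep.exists_equiv`), hence `Ψ` is well defined. Since an irreducible `ρ` is surjective
(Burnside's theorem) and matrix algebras are simple, an ideal `I` not contained in `P` contains
some `r` with `ρ(r) = 1`. The constant coefficient of the characteristic polynomial of `π(r)` is
`±det π(r) = ±π(r) adj π(r)`, an element of `M π(I) M ∩ T` at which `γ_{N,P}` does not vanish. This
gives both the injectivity of `Ψ` and the equivalence of `M π(I) M ∩ T ⊆ Ψ(P)` with `I ⊆ P`
(`contraction_le_iff`), from which the topological assertions follow formally.

The finite generation of `T` holds for any finite set of `n × n` matrices over a commutative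
algebra (`fg_adjoin_coeff_charpoly`). By Amitsur's theorem (`coeff_charpolyRev_sum_mem`) the `i`-th coefficient `e_i` of `det (1 - t m)`, for a sum `m` of
matrices, is a polynomial in the coefficients `e_l` of products of `a` of the summands, where
`l * a ≤ i`. By Shirshov's lemma (`exists_pow_or_isDivided`) a long word in the generators contains
either the `(n + 1)`-st power of a word, to which the Cayley–Hamilton theorem applies, or a divided
factor, which the standard identity of degree `n ^ 2 + 1` expresses by lexicographically smaller
words. In both cases Amitsur's theorem expresses `e_i` of the word by coefficients that come
earlier in a well-founded order, so the `e_i` of finitely many words generate.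

Finally, the image of `Prim R` in `k^q` is the union over `m ≤ d` of the images, under polynomial
maps, of the varieties of irreducible representations of dimension `m`. Each of these is open in a
closed subset of an affine space: irreducibility means that some `m ^ 2` elements of the free
algebra are represented by linearly independent matrices. So Chevalley's theorem applies, in the
form `isConstructible_image` for points over an algebraically closed field.
-/

namespace AffinePI

universe u

/-! ### Shirshov's lemma on words -/

section Shirshov

/-- A list of nonempty, pairwise distinct words is *divided* if concatenating the words in any
other order gives a lexicographically smaller word. -/
def IsDivided {α : Type u} [LinearOrder α] (ws : List (List α)) : Prop :=
  ws.Nodup ∧ (∀ v ∈ ws, v ≠ []) ∧ ∀ vs, vs.Perm ws → vs ≠ ws → vs.flatten < ws.flatten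

/-- The blocks used in Shirshov's induction: a positive power of the letter `x` followed by a
nonempty word in the letters of `S`. -/
def IsBlock {α : Type u} (x : α) (S : Finset α) (b : List α) : Prop :=
  ∃ i v, b = List.replicate (i + 1) x ++ v ∧ v ≠ [] ∧ ∀ a ∈ v, a ∈ S

variable {α : Type u}

theorem IsBlock.exists_cons {x : α} {S : Finset α} {b : List α} (h : IsBlock x S b) :
    ∃ c, b = x :: c := by
  obtain ⟨i, v, rfl, -, -⟩ := h
  exact ⟨List.replicate i x ++ v, by simp [List.replicate_succ]⟩

theorem IsBlock.exists_concat {x : α} {S : Finset α} {b : List α} (h : IsBlock x S b) :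
    ∃ c y, b = c ++ [y] ∧ y ∈ S := by
  obtain ⟨i, v, rfl, hv, hS⟩ := h
  refine ⟨List.replicate (i + 1) x ++ v.dropLast, v.getLast hv, ?_, hS _ (List.getLast_mem hv)⟩
  rw [List.append_assoc, List.dropLast_append_getLast hv]

/-- Parsing a word in `x` and the letters of `S` into blocks, up to a word without `x` at the
beginning and a power of `x` at the end. -/
theorem exists_blocks [DecidableEq α] (x : α) (S : Finset α) (w : List α)
    (hw : ∀ a ∈ w, a ∈ insert x S) :
    ∃ (v : List α) (B : List (List α)) (j : ℕ), w = v ++ B.flatten ++ List.replicate j x ∧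
      (∀ a ∈ v, a ∈ S) ∧ ∀ b ∈ B, IsBlock x S b := by
  induction w with
  | nil => exact ⟨[], [], 0, by simp⟩
  | cons a w ih =>
    obtain ⟨v, B, j, h, hv, hB⟩ := ih fun b hb => hw b (List.mem_cons_of_mem _ hb)
    rcases Finset.mem_insert.1 (hw a List.mem_cons_self) with rfl | ha
    · rcases eq_or_ne v [] with rfl | hv0
      · cases B with
        | nil => exact ⟨[], [], j + 1, by simp [h, List.replicate_succ]⟩
        | cons b B =>
          refine ⟨[], (a :: b) :: B, j, by simp [h], by simp, ?_⟩
          intro c hc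
          rcases List.mem_cons.1 hc with rfl | hc
          · obtain ⟨i, u, rfl, hu, hS⟩ := hB b List.mem_cons_self
            exact ⟨i + 1, u, by simp [List.replicate_succ], hu, hS⟩
          · exact hB c (List.mem_cons_of_mem _ hc)
      · refine ⟨[], (a :: v) :: B, j, by simp [h], by simp, ?_⟩
        intro c hc
        rcases List.mem_cons.1 hc with rfl | hc
        · exact ⟨0, v, by simp, hv0, hv⟩
        · exact hB c hc
    · refine ⟨a :: v, B, j, by simp [h], ?_, hB⟩
      intro c hc
      rcases List.mem_cons.1 hc with rfl | hc
      · exact ha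
      · exact hv c hc

/-- If a block continues another one, the continuation does not involve `x`. -/
theorem mem_of_block_append {x : α} {S : Finset α} (hx : x ∉ S) :
    ∀ (j i : ℕ) {v v' c : List α}, v' ≠ [] → (∀ a ∈ v', a ∈ S) → (∀ a ∈ v, a ∈ S) →
      List.replicate j x ++ v' ++ c = List.replicate i x ++ v → ∀ a ∈ c, a ∈ S
  | 0, 0, v, v', c, _, _, hv, h, a, ha => hv a (by simp at h; simp [← h, ha])
  | 0, i + 1, v, v', c, hv0, hv', _, h, a, ha => by
    cases v' with
    | nil => exact absurd rfl hv0
    | cons y v' =>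
      simp [List.replicate_succ] at h
      exact absurd (hv' y List.mem_cons_self) (h.1 ▸ hx)
  | j + 1, 0, v, v', c, _, _, hv, h, a, ha => by
    have : x ∈ v := by simp at h; simp [← h]
    exact absurd (hv x this) hx
  | j + 1, i + 1, v, v', c, hv0, hv', hv, h, a, ha => by
    refine mem_of_block_append hx j i hv0 hv' hv ?_ a ha
    simpa [List.replicate_succ] using h

theorem exists_perm_of_perm_map {β : Type*} (f : α → β) {t : List β} {l : List α}
    (h : t.Perm (l.map f)) : ∃ l' : List α, l'.Perm l ∧ t = l'.map f := by
  generalize hm : l.map f = m at h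
  induction h generalizing l with
  | nil => exact ⟨l, .refl _, hm.symm⟩
  | cons y _ ih =>
    obtain ⟨a, l, rfl, rfl, rfl⟩ := List.map_eq_cons_iff.1 hm
    obtain ⟨l', hl', rfl⟩ := ih rfl
    exact ⟨a :: l', hl'.cons a, rfl⟩
  | swap y z r =>
    obtain ⟨a, l, rfl, rfl, h2⟩ := List.map_eq_cons_iff.1 hm
    obtain ⟨b, l, rfl, rfl, rfl⟩ := List.map_eq_cons_iff.1 h2
    exact ⟨b :: a :: l, .swap _ _ _, rfl⟩
  | trans _ _ ih₁ ih₂ =>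
    obtain ⟨l', hl', rfl⟩ := ih₂ hm
    obtain ⟨l'', hl'', rfl⟩ := ih₁ rfl
    exact ⟨l'', hl''.trans hl', rfl⟩

theorem finite_words (S : Finset α) (K : ℕ) :
    {l : List α | (∀ a ∈ l, a ∈ S) ∧ l.length ≤ K}.Finite := by
  refine ((List.finite_length_le S K).image (List.map Subtype.val)).subset ?_
  rintro l ⟨hl, hK⟩
  exact ⟨l.attach.map fun a => ⟨a.1, hl a.1 a.2⟩, by simpa using hK, by simp⟩

theorem length_flatten_le {K : ℕ} {B : List (List α)} (h : ∀ b ∈ B, b.length ≤ K) :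
    B.flatten.length ≤ B.length * K := by
  induction B with
  | nil => simp
  | cons b B ih =>
    have h1 := h b List.mem_cons_self
    have h2 := ih fun c hc => h c (List.mem_cons_of_mem _ hc)
    simp only [List.flatten_cons, List.length_append, List.length_cons]
    rw [add_mul, one_mul]
    omega

theorem flatten_isInfix_flatten {A B : List (List α)} (h : A <:+: B) :
    A.flatten <:+: B.flatten := by
  obtain ⟨p, r, rfl⟩ := h
  exact ⟨p.flatten, r.flatten, by simp⟩

variable [LinearOrder α]

/-- Two words in lexicographic order either agree up to the end of the smaller one or differ at
some letter. -/
theorem lt_cases {a b : List α} (h : a < b) :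
    (∃ c, c ≠ [] ∧ b = a ++ c) ∨
      ∃ p s t a' b', a = p ++ s :: a' ∧ b = p ++ t :: b' ∧ s < t := by
  induction a generalizing b with
  | nil =>
    left
    exact ⟨b, by rintro rfl; exact lt_irrefl _ h, rfl⟩
  | cons x a ih =>
    cases b with
    | nil => simp at h
    | cons y b =>
      rcases List.cons_lt_cons_iff.1 h with hxy | ⟨rfl, hab⟩
      · right; exact ⟨[], x, y, a, b, rfl, rfl, hxy⟩
      · rcases ih hab with ⟨c, hc, rfl⟩ | ⟨p, s, t, a', b', rfl, rfl, hst⟩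
        · left; exact ⟨c, hc, rfl⟩
        · right; exact ⟨x :: p, s, t, a', b', rfl, rfl, hst⟩

theorem append_lt_append_left {a b : List α} (p : List α) (h : a < b) : p ++ a < p ++ b := by
  induction p with
  | nil => exact h
  | cons x p ih => exact List.cons_lt_cons_iff.2 (Or.inr ⟨rfl, ih⟩)

/-- Lexicographic comparison of sequences of blocks, the blocks themselves being compared
lexicographically, agrees with that of the words they spell. If a block is a proper prefix of
another one, it is followed by the letter `x`, which is smaller than the remaining letters of the
longer block. -/
theorem flatten_lt_flatten {x : α} {S : Finset α} (hx : ∀ y ∈ S, x < y) :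
    ∀ {A B : List (List α)}, (∀ b ∈ A, IsBlock x S b) → (∀ b ∈ B, IsBlock x S b) → A < B →
      A.flatten.length = B.flatten.length → A.flatten < B.flatten
  | _, [], _, _, h, _ => by simp at h
  | [], b :: B, _, hB, _, hl => by
    obtain ⟨c, rfl⟩ := (hB b List.mem_cons_self).exists_cons
    simp at hl
  | a :: A, b :: B, hA, hB, h, hl => by
    have hA' : ∀ b ∈ A, IsBlock x S b := fun c hc => hA c (List.mem_cons_of_mem _ hc)
    have hB' : ∀ b ∈ B, IsBlock x S b := fun c hc => hB c (List.mem_cons_of_mem _ hc)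
    rw [List.flatten_cons, List.flatten_cons]
    rcases List.cons_lt_cons_iff.1 h with hab | ⟨rfl, hAB⟩
    · rcases lt_cases hab with ⟨c, hc, rfl⟩ | ⟨p, s, t, a', b', rfl, rfl, hst⟩
      · rw [List.append_assoc]
        apply append_lt_append_left
        obtain ⟨z, c, rfl⟩ := List.exists_cons_of_ne_nil hc
        cases A with
        | nil => simp at hl
        | cons a₂ A =>
          obtain ⟨d, rfl⟩ := (hA' a₂ List.mem_cons_self).exists_cons
          refine List.cons_lt_cons_iff.2 (Or.inl (hx z ?_))
          obtain ⟨j, v', rfl, hv0, hv'⟩ := hA a List.mem_cons_self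
          obtain ⟨i, v, hb, -, hv⟩ := hB _ List.mem_cons_self
          exact mem_of_block_append (fun h => lt_irrefl x (hx x h)) _ _ hv0 hv' hv hb z
            List.mem_cons_self
      · rw [List.append_assoc, List.append_assoc]
        exact append_lt_append_left _ (List.cons_lt_cons_iff.2 (Or.inl hst))
    · apply append_lt_append_left
      exact flatten_lt_flatten hx hA' hB' hAB (by simpa using hl)

/-- A divided sequence of words in the blocks spells a divided sequence of words, and putting in
front a letter larger than `x` makes it one longer. -/
theorem IsDivided.cons_map_flatten {x y : α} {S : Finset α} (hx : ∀ y ∈ S, x < y) (hy : x < y)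
    {Ws : List (List (List α))} (hW : IsDivided Ws) (hB : ∀ W ∈ Ws, ∀ b ∈ W, IsBlock x S b) :
    IsDivided ([y] :: Ws.map List.flatten) := by
  obtain ⟨hnd, hne, hlt⟩ := hW
  have hcons : ∀ v ∈ Ws.map List.flatten, ∃ c, v = x :: c := by
    intro v hv
    obtain ⟨W, hW, rfl⟩ := List.mem_map.1 hv
    obtain ⟨b, W, rfl⟩ := List.exists_cons_of_ne_nil (hne W hW)
    obtain ⟨c, rfl⟩ := (hB _ hW b List.mem_cons_self).exists_cons
    exact ⟨c ++ W.flatten, rfl⟩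
  refine ⟨List.nodup_cons.2 ⟨fun h => ?_, ?_⟩, ?_, ?_⟩
  · obtain ⟨c, hc⟩ := hcons _ h
    simp at hc
    exact hy.ne' hc.1
  · refine (List.nodup_map_iff_inj_on hnd).2 fun V hV W hW hVW => ?_
    by_contra hne'
    rcases lt_or_gt_of_ne hne' with h | h
    · exact (flatten_lt_flatten hx (hB V hV) (hB W hW) h (by rw [hVW])).ne hVW
    · exact (flatten_lt_flatten hx (hB W hW) (hB V hV) h (by rw [hVW])).ne hVW.symm
  · intro v hv
    rcases List.mem_cons.1 hv with rfl | hv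
    · simp
    · obtain ⟨c, rfl⟩ := hcons v hv
      simp
  · intro vs hvs hne'
    cases vs with
    | nil => simp at hvs
    | cons h t =>
      by_cases hh : h = [y]
      · subst hh
        rw [List.perm_cons] at hvs
        obtain ⟨Vs, hVs, rfl⟩ := exists_perm_of_perm_map _ hvs
        have hVW : Vs ≠ Ws := by rintro rfl; exact hne' rfl
        rw [List.flatten_cons, List.flatten_cons]
        apply append_lt_append_left
        rw [← List.flatten_flatten, ← List.flatten_flatten]
        refine flatten_lt_flatten hx ?_ ?_ (hlt Vs hVs hVW) hVs.flatten.flatten.length_eq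
        · intro b hb
          obtain ⟨V, hV, hb⟩ := List.mem_flatten.1 hb
          exact hB V (hVs.subset hV) b hb
        · intro b hb
          obtain ⟨V, hV, hb⟩ := List.mem_flatten.1 hb
          exact hB V hV b hb
      · have : h ∈ [y] :: Ws.map List.flatten := hvs.subset List.mem_cons_self
        rcases List.mem_cons.1 this with h1 | h1
        · exact absurd h1 hh
        · obtain ⟨c, rfl⟩ := hcons h h1
          exact List.cons_lt_cons_iff.2 (Or.inl hy)

/-- **Shirshov's lemma**: a long word in finitely many letters contains a `q`-th power of a
nonempty word, or a factor that splits into a divided sequence of `n` words. -/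
theorem exists_pow_or_isDivided {q : ℕ} (hq : 0 < q) (n : ℕ) :
    ∀ {α : Type u} [LinearOrder α] (S : Finset α), ∃ L, ∀ w : List α, (∀ a ∈ w, a ∈ S) →
      L ≤ w.length → (∃ u, u ≠ [] ∧ (List.replicate q u).flatten <:+: w) ∨
        ∃ ws : List (List α), ws.length = n ∧ IsDivided ws ∧ ws.flatten <:+: w := by
  induction n with
  | zero =>
    intro α _ S
    exact ⟨0, fun w _ _ => Or.inr ⟨[], rfl,
      ⟨List.nodup_nil, by simp, fun vs h h' => absurd (List.perm_nil.1 h) h'⟩,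
      List.nil_infix⟩⟩
  | succ n ihn =>
    intro α _ S
    induction S using Finset.induction_on_min with
    | empty =>
      refine ⟨1, fun w hw hl => ?_⟩
      obtain ⟨a, w, rfl⟩ := List.exists_cons_of_length_pos hl
      simpa using hw a List.mem_cons_self
    | insert x S hx ihS =>
      obtain ⟨LS, hLS⟩ := ihS
      set K := q + LS with hK
      obtain ⟨L', hL'⟩ := ihn (finite_words (insert x S) K).toFinset
      refine ⟨LS + (L' + 1) * K + q, fun w hw hl => ?_⟩
      -- a long factor without the letter `x` settles the claim by the induction on `S`
      by_cases hlong : ∃ v, v <:+: w ∧ (∀ a ∈ v, a ∈ S) ∧ LS ≤ v.length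
      · obtain ⟨v, hvw, hv, hlv⟩ := hlong
        rcases hLS v hv hlv with ⟨u, hu, h⟩ | ⟨ws, h1, h2, h3⟩
        · exact Or.inl ⟨u, hu, h.trans hvw⟩
        · exact Or.inr ⟨ws, h1, h2, h3.trans hvw⟩
      by_cases hpow : List.replicate q x <:+: w
      · exact Or.inl ⟨[x], by simp, by simpa using hpow⟩
      push Not at hlong
      have hrep : ∀ j, List.replicate j x <:+: w → j < q := by
        intro j hj
        by_contra! hjq
        refine hpow (List.IsInfix.trans ⟨[], List.replicate (j - q) x, ?_⟩ hj)
        rw [List.nil_append, List.replicate_append_replicate]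
        congr 1
        omega
      obtain ⟨v, B, j, rfl, hv, hB⟩ := exists_blocks x S w hw
      have hvl := hlong v ⟨[], B.flatten ++ List.replicate j x, by simp⟩ hv
      have hjl := hrep j ⟨v ++ B.flatten, [], by simp⟩
      have hBw : B.flatten <:+: v ++ B.flatten ++ List.replicate j x := ⟨_, _, rfl⟩
      have hbw : ∀ b ∈ B, b <:+: v ++ B.flatten ++ List.replicate j x := fun b hb => by
        obtain ⟨p, r, rfl⟩ := List.append_of_mem hb
        exact List.IsInfix.trans ⟨p.flatten, r.flatten, by simp⟩ hBw
      have hBK : ∀ b ∈ B, b.length ≤ K := by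
        intro b hb
        have hb' := hbw b hb
        obtain ⟨i, u, rfl, -, hu⟩ := hB b hb
        have h1 := hrep (i + 1) (List.IsInfix.trans ⟨[], u, by simp⟩ hb')
        have h2 := hlong u (List.IsInfix.trans ⟨List.replicate (i + 1) x, [], by simp⟩ hb') hu
        simp only [List.length_append, List.length_replicate]
        omega
      have hBl : L' + 1 ≤ B.length := by
        by_contra! hlt
        have h1 := length_flatten_le hBK
        have h2 : B.length * K ≤ (L' + 1) * K := Nat.mul_le_mul_right _ hlt.le
        simp only [List.length_append, List.length_replicate] at hl
        omega
      obtain ⟨b, B, rfl⟩ := List.exists_cons_of_length_pos (lt_of_lt_of_le (Nat.succ_pos _) hBl)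
      have hBB : B.flatten <:+: v ++ (b :: B).flatten ++ List.replicate j x :=
        List.IsInfix.trans ⟨b, [], by simp⟩ hBw
      rcases hL' B (fun c hc => by
          have hc' := List.mem_cons_of_mem b hc
          refine (Set.Finite.mem_toFinset _).2 ⟨fun a ha => hw a ?_, hBK c hc'⟩
          exact (hbw c hc').subset ha) (by simpa using hBl) with ⟨u, hu, h⟩ | ⟨Ws, h1, h2, h3⟩
      · left
        refine ⟨u.flatten, ?_, ?_⟩
        · obtain ⟨c, u, rfl⟩ := List.exists_cons_of_ne_nil hu
          have : c ∈ B := h.subset (List.mem_flatten.2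
            ⟨c :: u, List.mem_replicate.2 ⟨hq.ne', rfl⟩, List.mem_cons_self⟩)
          obtain ⟨e, rfl⟩ := (hB c (List.mem_cons_of_mem _ this)).exists_cons
          simp
        · have := (flatten_isInfix_flatten h).trans hBB
          rwa [List.flatten_flatten, List.map_replicate] at this
      · right
        obtain ⟨p, r, hpr⟩ := h3
        -- the last letter `y` of the block preceding the divided factor
        obtain ⟨pre, e, he⟩ : ∃ pre e, b :: p = pre ++ [e] :=
          ⟨_, _, (List.dropLast_append_getLast (List.cons_ne_nil b p)).symm⟩
        have heB : e ∈ b :: B := by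
          rw [← hpr, ← List.cons_append, ← List.cons_append, he]
          simp
        obtain ⟨c, y, rfl, hy⟩ := (hB e heB).exists_concat
        refine ⟨[y] :: Ws.map List.flatten, by simp [h1],
          h2.cons_map_flatten hx (hx y hy) fun W hW d hd => hB d (List.mem_cons_of_mem _ ?_), ?_⟩
        · rw [← hpr]
          simp only [List.mem_append, List.mem_flatten]
          exact Or.inl (Or.inr ⟨W, hW, hd⟩)
        · refine List.IsInfix.trans ⟨pre.flatten ++ c, r.flatten, ?_⟩ hBw
          rw [← hpr, ← List.cons_append, ← List.cons_append, he]
          simp [List.flatten_flatten]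

end Shirshov

/-! ### Amitsur's expansion of the characteristic polynomial of a sum -/

section Amitsur

open Polynomial

variable {ι C : Type*} [DecidableEq ι] [CommRing C]

/-- The pencil `1 - ∑ X ^ a • m`, where `(a, m)` runs over a list of matrices with weights. -/
noncomputable def pencil (L : List (ℕ × Matrix ι ι C)) : Matrix ι ι C[X] :=
  1 - (L.map fun p => (X ^ p.1 : C[X]) • p.2.map Polynomial.C).sum

theorem pencil_perm {L L' : List (ℕ × Matrix ι ι C)} (h : L.Perm L') : pencil L = pencil L' := by
  rw [pencil, pencil, (h.map _).sum_eq]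

variable [Fintype ι]

theorem coeff_charpolyRev_zero (M : Matrix ι ι C) : M.charpolyRev.coeff 0 = 1 := by
  rw [coeff_zero_eq_eval_zero, Matrix.eval_charpolyRev]

theorem det_one_sub_X_pow_smul (M : Matrix ι ι C) (a : ℕ) :
    (1 - (X ^ a : C[X]) • M.map Polynomial.C).det = expand C a M.charpolyRev := by
  rw [Matrix.charpolyRev, AlgHom.map_det]
  congr 1
  ext i j
  simp [Matrix.one_apply, apply_ite (expand C a)]

theorem coeff_charpolyRev_smul (c : C) (M : Matrix ι ι C) (l : ℕ) :
    (c • M).charpolyRev.coeff l = c ^ l * M.charpolyRev.coeff l := by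
  have h : (c • M).charpolyRev = M.charpolyRev.comp (Polynomial.C c * X) := by
    rw [Matrix.charpolyRev, Matrix.charpolyRev, ← coe_compRingHom_apply, RingHom.map_det]
    refine congrArg Matrix.det (Matrix.ext fun i j => ?_)
    rcases eq_or_ne i j with rfl | hij
    · simp
      ring
    · simp [hij]
      ring
  rw [h, comp_C_mul_X_coeff, mul_comm]

/-- The coefficients up to degree `D` of the polynomial `p` lie in `G`. -/
def CoeffsMem (G : Subring C) (D : ℕ) (p : C[X]) : Prop := ∀ i ≤ D, p.coeff i ∈ G

theorem CoeffsMem.mul {G : Subring C} {D : ℕ} {p q : C[X]} (hp : CoeffsMem G D p)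
    (hq : CoeffsMem G D q) : CoeffsMem G D (p * q) := by
  intro i hi
  rw [Polynomial.coeff_mul]
  refine sum_mem fun x hx => ?_
  have := Finset.HasAntidiagonal.mem_antidiagonal.1 hx
  exact mul_mem (hp _ (by omega)) (hq _ (by omega))

theorem CoeffsMem.congr {G : Subring C} {D : ℕ} {p q : C[X]} (hp : CoeffsMem G D p)
    (h : X ^ (D + 1) ∣ p - q) : CoeffsMem G D q := by
  intro i hi
  have := X_pow_dvd_iff.1 h i (by omega)
  rw [coeff_sub, sub_eq_zero] at this
  exact this ▸ hp i hi

theorem dvd_det_sub_det {A : Type*} [CommRing A] (a : A) {M M' : Matrix ι ι A}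
    (h : ∀ i j, a ∣ M i j - M' i j) : a ∣ M.det - M'.det := by
  rw [← Ideal.mem_span_singleton, ← Ideal.Quotient.eq, RingHom.map_det, RingHom.map_det]
  congr 1
  ext i j
  exact Ideal.Quotient.eq.2 (Ideal.mem_span_singleton.2 (h i j))

/-- The new weighted matrices that arise when `p` is eliminated from the pencil of `p :: L`. -/
def elimList (D : ℕ) (p : ℕ × Matrix ι ι C) (L : List (ℕ × Matrix ι ι C)) :
    List (ℕ × Matrix ι ι C) :=
  (List.range D).flatMap fun j => L.map fun r => ((j + 1) * p.1 + r.1, p.2 ^ (j + 1) * r.2)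

theorem sum_elimList (D : ℕ) (p : ℕ × Matrix ι ι C) (L : List (ℕ × Matrix ι ι C)) :
    ((elimList D p L).map fun p => (X ^ p.1 : C[X]) • p.2.map Polynomial.C).sum =
      (∑ j ∈ Finset.range D, ((X ^ p.1 : C[X]) • p.2.map Polynomial.C) ^ (j + 1)) *
        (L.map fun p => (X ^ p.1 : C[X]) • p.2.map Polynomial.C).sum := by
  have key : ∀ j, ((L.map fun r => ((j + 1) * p.1 + r.1, p.2 ^ (j + 1) * r.2)).map
      fun p => (X ^ p.1 : C[X]) • p.2.map Polynomial.C).sum =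
      ((X ^ p.1 : C[X]) • p.2.map Polynomial.C) ^ (j + 1) *
        (L.map fun p => (X ^ p.1 : C[X]) • p.2.map Polynomial.C).sum := by
    intro j
    rw [List.map_map, ← List.sum_map_mul_left]
    congr 1
    refine List.map_congr_left fun r _ => ?_
    have h : (p.2 ^ (j + 1) * r.2).map Polynomial.C =
        (p.2.map Polynomial.C) ^ (j + 1) * r.2.map Polynomial.C := by
      rw [← RingHom.mapMatrix_apply, ← RingHom.mapMatrix_apply, ← RingHom.mapMatrix_apply,
        map_mul, map_pow]
    simp only [Function.comp_apply]
    rw [h, _root_.smul_pow, smul_mul_smul_comm, ← pow_mul, ← pow_add, mul_comm p.1]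
  induction D with
  | zero => simp [elimList]
  | succ D ih =>
    rw [Finset.sum_range_succ, add_mul, ← ih, ← key]
    simp [elimList, List.range_succ]

/-- Eliminating `p`: modulo `X ^ (D + 1)` the pencil of `p :: L` is the product of that of `p`
with a pencil in which `p` is replaced by weighted matrices of larger weight. This is the geometric
series `1 - x - S = (1 - x) (1 - (1 + x + x ^ 2 + ⋯) S)`. -/
theorem dvd_pencil_mul_sub {p : ℕ × Matrix ι ι C} (hp : 0 < p.1) (D : ℕ)
    (L : List (ℕ × Matrix ι ι C)) (i j : ι) :
    X ^ (D + 1) ∣ ((1 - (X ^ p.1 : C[X]) • p.2.map Polynomial.C) *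
      pencil (L ++ elimList D p L)) i j - pencil (p :: L) i j := by
  set x := (X ^ p.1 : C[X]) • p.2.map Polynomial.C with hx
  set S := (L.map fun p => (X ^ p.1 : C[X]) • p.2.map Polynomial.C).sum with hS
  have h1 : pencil (L ++ elimList D p L) = 1 - (∑ j ∈ Finset.range (D + 1), x ^ j) * S := by
    rw [pencil, List.map_append, List.sum_append, sum_elimList, ← hS, ← hx,
      Finset.sum_range_succ', pow_zero, add_mul, one_mul, add_comm]
  have h2 : pencil (p :: L) = 1 - x - S := by
    rw [pencil, List.map_cons, List.sum_cons, ← hS, ← hx, sub_sub]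
  have h3 : (1 - x) * pencil (L ++ elimList D p L) - pencil (p :: L) = x ^ (D + 1) * S := by
    rw [h1, h2, mul_sub, ← mul_assoc, mul_neg_geom_sum]
    noncomm_ring
  have h4 : x ^ (D + 1) * S = (X ^ (D + 1) : C[X]) •
      ((X ^ ((p.1 - 1) * (D + 1)) : C[X]) • ((p.2.map Polynomial.C) ^ (D + 1) * S)) := by
    rw [hx, _root_.smul_pow, smul_mul_assoc, smul_smul, ← pow_mul, ← pow_add]
    congr 2
    obtain ⟨a, ha⟩ := Nat.exists_eq_add_of_lt hp
    rw [ha]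
    simp only [zero_add, Nat.add_sub_cancel]
    ring
  rw [← Matrix.sub_apply, h3, h4, Matrix.smul_apply, smul_eq_mul]
  exact dvd_mul_right _ _

variable {D : ℕ} {G : Subring C} {𝒮 : ℕ → Matrix ι ι C → Prop}

theorem weighted_pow_mul (hmul : ∀ {a b m m'}, 𝒮 a m → 𝒮 b m' → 𝒮 (a + b) (m * m'))
    {a b : ℕ} {m m' : Matrix ι ι C} (hm : 𝒮 a m) (hm' : 𝒮 b m') (j : ℕ) :
    𝒮 (j * a + b) (m ^ j * m') := by
  induction j with
  | zero => simpa using hm'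
  | succ j ih =>
    have := hmul hm ih
    rwa [← add_assoc, ← mul_assoc, ← pow_succ', add_comm a, ← Nat.succ_mul] at this

/-- Eliminating one after another the weighted matrices of weight `e`. -/
theorem coeffsMem_det_pencil_append
    (hmul : ∀ {a b m m'}, 𝒮 a m → 𝒮 b m' → 𝒮 (a + b) (m * m')) (hpos : ∀ {a m}, 𝒮 a m → 0 < a)
    (hG : ∀ {a m}, 𝒮 a m → ∀ l, 0 < l → l * a ≤ D → m.charpolyRev.coeff l ∈ G) {e : ℕ}
    (hbig : ∀ L, (∀ p ∈ L, 𝒮 p.1 p.2 ∧ e < p.1) → CoeffsMem G D (pencil L).det)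
    (A B : List (ℕ × Matrix ι ι C)) (hA : ∀ p ∈ A, 𝒮 p.1 p.2 ∧ p.1 = e)
    (hB : ∀ p ∈ B, 𝒮 p.1 p.2 ∧ e < p.1) : CoeffsMem G D (pencil (A ++ B)).det := by
  induction A generalizing B with
  | nil => exact hbig B hB
  | cons p A ih =>
    obtain ⟨hp, rfl⟩ := hA p List.mem_cons_self
    have hA' : ∀ r ∈ A, 𝒮 r.1 r.2 ∧ r.1 = p.1 := fun r hr => hA r (List.mem_cons_of_mem _ hr)
    have hnew : ∀ r ∈ B ++ elimList D p (A ++ B), 𝒮 r.1 r.2 ∧ p.1 < r.1 := by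
      intro r hr
      rcases List.mem_append.1 hr with hr | hr
      · exact hB r hr
      · obtain ⟨j, -, hr₁⟩ := List.mem_flatMap.1 hr
        obtain ⟨t, ht, rfl⟩ := List.mem_map.1 hr₁
        have hr' : 𝒮 t.1 t.2 := by
          rcases List.mem_append.1 ht with ht | ht
          exacts [(hA' t ht).1, (hB t ht).1]
        refine ⟨weighted_pow_mul hmul hp hr' (j + 1), ?_⟩
        have := hpos hr'
        simp only [add_mul, one_mul]
        omega
    have h1 := ih _ hA' hnew
    have h2 : CoeffsMem G D (1 - (X ^ p.1 : C[X]) • p.2.map Polynomial.C).det := by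
      intro i hi
      rw [det_one_sub_X_pow_smul, coeff_expand (hpos hp)]
      split_ifs with hdvd
      · obtain ⟨l, rfl⟩ := hdvd
        rw [Nat.mul_div_cancel_left _ (hpos hp)]
        rcases Nat.eq_zero_or_pos l with rfl | hl
        · rw [coeff_charpolyRev_zero]
          exact one_mem G
        · exact hG hp l hl (by rwa [mul_comm])
      · exact zero_mem G
    have h3 := h2.mul h1
    rw [← Matrix.det_mul] at h3
    refine h3.congr (dvd_det_sub_det _ fun i j => ?_)
    rw [← List.append_assoc, List.cons_append]
    exact dvd_pencil_mul_sub (hpos hp) D (A ++ B) i j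

/-- If a family `𝒮` of weighted matrices is closed under products, the low coefficients of the
determinant of a pencil over `𝒮` belong to any subring that contains the low coefficients of the
reversed characteristic polynomials of the members of `𝒮`. -/
theorem coeffsMem_det_pencil
    (hmul : ∀ {a b m m'}, 𝒮 a m → 𝒮 b m' → 𝒮 (a + b) (m * m')) (hpos : ∀ {a m}, 𝒮 a m → 0 < a)
    (hG : ∀ {a m}, 𝒮 a m → ∀ l, 0 < l → l * a ≤ D → m.charpolyRev.coeff l ∈ G)
    (L : List (ℕ × Matrix ι ι C)) (hL : ∀ p ∈ L, 𝒮 p.1 p.2) :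
    CoeffsMem G D (pencil L).det := by
  have key : ∀ e, ∀ L : List (ℕ × Matrix ι ι C), (∀ p ∈ L, 𝒮 p.1 p.2 ∧ D < p.1 + e) →
      CoeffsMem G D (pencil L).det := by
    intro e
    induction e with
    | zero =>
      intro L hL
      have h1 : CoeffsMem G D ((1 : Matrix ι ι C[X]).det) := by
        intro i _
        rw [Matrix.det_one, coeff_one]
        split_ifs
        exacts [one_mem G, zero_mem G]
      refine h1.congr (dvd_det_sub_det _ fun i j => ?_)
      rw [pencil, Matrix.sub_apply, sub_sub_cancel]
      induction L with
      | nil => simp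
      | cons p L ih =>
        rw [List.map_cons, List.sum_cons, Matrix.add_apply]
        refine dvd_add ?_ (ih fun r hr => hL r (List.mem_cons_of_mem _ hr))
        rw [Matrix.smul_apply, smul_eq_mul]
        exact Dvd.dvd.mul_right (pow_dvd_pow _ (hL p List.mem_cons_self).2) _
    | succ e ih =>
      intro L hL
      let q : ℕ × Matrix ι ι C → Bool := fun p => decide (p.1 = D - e)
      rw [← pencil_perm (List.filter_append_perm q L)]
      refine coeffsMem_det_pencil_append hmul hpos hG (e := D - e)
        (fun L' hL' => ih L' fun p hp => ⟨(hL' p hp).1, ?_⟩) _ _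
        (fun p hp => ?_) fun p hp => ?_
      · have := (hL' p hp).2
        omega
      · obtain ⟨h1, h2⟩ := List.mem_filter.1 hp
        exact ⟨(hL p h1).1, by simpa [q] using h2⟩
      · obtain ⟨h1, h2⟩ := List.mem_filter.1 hp
        have h3 : p.1 ≠ D - e := by simpa [q] using h2
        have h4 := (hL p h1).2
        have h5 := hpos (hL p h1).1
        exact ⟨(hL p h1).1, by omega⟩
  refine key D L fun p hp => ⟨hL p hp, ?_⟩
  have := hpos (hL p hp)
  omega

/-- **Amitsur's theorem**, qualitatively: the `i`-th coefficient of the reversed characteristic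
polynomial of a sum of matrices is a polynomial, with integral coefficients, in the `l`-th
coefficients of the reversed characteristic polynomials of the products `m` of `a` of the summands,
where `0 < l`, `0 < a` and `l * a ≤ i`. -/
theorem coeff_charpolyRev_sum_mem {J : Type*} (G : Subring C) (i : ℕ) (s : List J)
    (M : J → Matrix ι ι C)
    (hG : ∀ μ : List J, μ ≠ [] → (∀ j ∈ μ, j ∈ s) → ∀ l, 0 < l → l * μ.length ≤ i →
      ((μ.map M).prod).charpolyRev.coeff l ∈ G) :
    ((s.map M).sum).charpolyRev.coeff i ∈ G := by
  let 𝒮 : ℕ → Matrix ι ι C → Prop := fun a m => ∃ μ : List J, μ ≠ [] ∧ (∀ j ∈ μ, j ∈ s) ∧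
    a = μ.length ∧ m = (μ.map M).prod
  have h := coeffsMem_det_pencil (D := i) (G := G) (𝒮 := 𝒮)
    (by
      rintro a b m m' ⟨μ, hμ, hs, rfl, rfl⟩ ⟨ν, -, hs', rfl, rfl⟩
      refine ⟨μ ++ ν, by simp [hμ], ?_, by simp, by simp⟩
      intro j hj
      exact (List.mem_append.1 hj).elim (hs j) (hs' j))
    (by
      rintro a m ⟨μ, hμ, -, rfl, -⟩
      exact List.length_pos_iff.2 hμ)
    (by
      rintro a m ⟨μ, hμ, hs, rfl, rfl⟩ l hl hli
      exact hG μ hμ hs l hl hli)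
    (s.map fun j => (1, M j)) (by
      intro p hp
      obtain ⟨j, hj, rfl⟩ := List.mem_map.1 hp
      exact ⟨[j], by simp, by simpa using hj, by simp, by simp⟩) i le_rfl
  have hsum : ∀ t : List J, (t.map fun j => (X : C[X]) • (M j).map Polynomial.C).sum =
      (X : C[X]) • ((t.map M).sum).map Polynomial.C := by
    intro t
    induction t with
    | nil => simp
    | cons j t ih =>
      rw [List.map_cons, List.sum_cons, ih, List.map_cons, List.sum_cons,
        Matrix.map_add _ (by simp), smul_add]
  have h2 : pencil (s.map fun j => (1, M j)) =
      1 - (X : C[X]) • ((s.map M).sum).map Polynomial.C := by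
    rw [pencil, List.map_map, ← hsum]
    simp [Function.comp_def]
  rwa [h2] at h

end Amitsur

/-! ### Finite generation of the algebra of coefficients of characteristic polynomials -/

section Words

variable {ι C : Type*} [Fintype ι] [DecidableEq ι] [CommRing C]

/-- The standard identity of degree `m > (card ι) ^ 2` holds in the algebra of matrices, because
the standard polynomial is multilinear and alternating. -/
theorem standard_identity {m : ℕ} (hm : Fintype.card ι * Fintype.card ι < m)
    (f : Fin m → Matrix ι ι C) :
    ∑ σ : Equiv.Perm (Fin m), Equiv.Perm.sign σ • (List.ofFn (f ∘ σ)).prod = 0 := by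
  have h : MultilinearMap.alternatization (MultilinearMap.mkPiAlgebraFin C m (Matrix ι ι C)) =
      0 := by
    refine Module.Basis.ext_alternating (Matrix.stdBasis C ι ι) fun v hv => ?_
    have := Fintype.card_le_of_injective v hv
    rw [Fintype.card_fin, Fintype.card_prod] at this
    omega
  have h2 := congrArg (fun g => g f) h
  simpa [MultilinearMap.alternatization_apply, Function.comp_def] using h2

theorem charpolyRev_coeff_of_le [Nontrivial C] (M : Matrix ι ι C) {j : ℕ}
    (hj : j ≤ Fintype.card ι) :
    M.charpoly.coeff j = M.charpolyRev.coeff (Fintype.card ι - j) := by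
  rw [← Matrix.reverse_charpoly, Polynomial.coeff_reverse, Matrix.charpoly_natDegree_eq_dim,
    Polynomial.revAt_le (by omega), Nat.sub_sub_self hj]

theorem charpolyRev_coeff_eq_zero (M : Matrix ι ι C) {j : ℕ} (hj : Fintype.card ι < j) :
    M.charpolyRev.coeff j = 0 := by
  nontriviality C
  refine Polynomial.coeff_eq_zero_of_natDegree_lt (lt_of_le_of_lt ?_ hj)
  rw [← Matrix.reverse_charpoly]
  exact (Polynomial.reverse_natDegree_le _).trans (Matrix.charpoly_natDegree_eq_dim M).le

/-- The Cayley–Hamilton theorem, solved for the leading power. -/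
theorem pow_card_eq_sum [Nontrivial C] (M : Matrix ι ι C) :
    M ^ Fintype.card ι = ∑ j ∈ Finset.range (Fintype.card ι), (-M.charpoly.coeff j) • M ^ j := by
  have h := Matrix.aeval_self_charpoly M
  rw [Polynomial.aeval_eq_sum_range, Matrix.charpoly_natDegree_eq_dim, Finset.sum_range_succ,
    ← Matrix.charpoly_natDegree_eq_dim M, Polynomial.coeff_natDegree,
    (Matrix.charpoly_monic M).leadingCoeff, one_smul] at h
  rw [← Matrix.charpoly_natDegree_eq_dim M, eq_neg_of_add_eq_zero_right h,
    ← Finset.sum_neg_distrib]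
  simp

theorem coeff_charpolyRev_sum_smul_mem {J : Type*} (G : Subring C) (i : ℕ) (s : Finset J)
    (c : J → C) (V : J → Matrix ι ι C)
    (hG : ∀ μ : List J, μ ≠ [] → (∀ j ∈ μ, j ∈ s) → ∀ l, 0 < l → l * μ.length ≤ i →
      (μ.map c).prod ∈ G ∧ ((μ.map V).prod).charpolyRev.coeff l ∈ G) :
    (∑ j ∈ s, c j • V j).charpolyRev.coeff i ∈ G := by
  rw [← Finset.sum_map_toList]
  refine coeff_charpolyRev_sum_mem G i _ _ fun μ hμ hs l hl hli => ?_
  have hprod : (μ.map fun j => c j • V j).prod = (μ.map c).prod • (μ.map V).prod := by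
    clear hμ hs hli
    induction μ with
    | nil => simp
    | cons j μ ih => simp only [List.map_cons, List.prod_cons, ih, smul_mul_smul_comm]
  obtain ⟨h1, h2⟩ := hG μ hμ (fun j hj => Finset.mem_toList.1 (hs j hj)) l hl hli
  rw [hprod, coeff_charpolyRev_smul]
  exact mul_mem (pow_mem h1 l) h2

theorem list_prod_map_mem {J : Type*} {G : Subring C} {c : J → C} {μ : List J}
    (h : ∀ j ∈ μ, c j ∈ G) : (μ.map c).prod ∈ G :=
  list_prod_mem fun x hx => by
    obtain ⟨j, hj, rfl⟩ := List.mem_map.1 hx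
    exact h j hj

variable {α : Type u}

/-- The product of the matrices `A a`, where `a` runs over the letters of the word `w`. -/
def wordProd (A : α → Matrix ι ι C) (w : List α) : Matrix ι ι C := (w.map A).prod

theorem wordProd_append (A : α → Matrix ι ι C) (v w : List α) :
    wordProd A (v ++ w) = wordProd A v * wordProd A w := by
  simp [wordProd]

theorem wordProd_flatten (A : α → Matrix ι ι C) (ws : List (List α)) :
    wordProd A ws.flatten = (ws.map (wordProd A)).prod := by
  induction ws with
  | nil => simp [wordProd]
  | cons w ws ih => simp [wordProd_append, ih]

theorem wordProd_flatten_replicate (A : α → Matrix ι ι C) (u : List α) (j : ℕ) :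
    wordProd A (List.replicate j u).flatten = wordProd A u ^ j := by
  simp [wordProd_flatten]

/-- In a word that contains a large power, the Cayley–Hamilton theorem reduces the exponent. -/
theorem wordProd_pow [Nontrivial C] (A : α → Matrix ι ι C) (p u r : List α) :
    wordProd A (p ++ (List.replicate (Fintype.card ι + 1) u).flatten ++ r) =
      ∑ j ∈ Finset.range (Fintype.card ι), (-(wordProd A u).charpoly.coeff j) •
        wordProd A (p ++ (List.replicate (j + 1) u).flatten ++ r) := by
  simp only [wordProd_append, wordProd_flatten_replicate]
  rw [pow_succ', pow_card_eq_sum, Finset.mul_sum, Finset.mul_sum, Finset.sum_mul]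
  refine Finset.sum_congr rfl fun j _ => ?_
  rw [mul_smul_comm, mul_smul_comm, smul_mul_assoc, ← pow_succ']

/-- In a word with a factor split into more than `(card ι) ^ 2` words, the standard identity
replaces the word by those with the parts of the factor permuted. -/
theorem wordProd_perm (A : α → Matrix ι ι C) {m : ℕ}
    (hm : Fintype.card ι * Fintype.card ι < m) (f : Fin m → List α) (p r : List α) :
    wordProd A (p ++ (List.ofFn f).flatten ++ r) =
      ∑ σ ∈ Finset.univ.erase (1 : Equiv.Perm (Fin m)), (-((Equiv.Perm.sign σ : ℤ) : C)) •
        wordProd A (p ++ (List.ofFn (f ∘ σ)).flatten ++ r) := by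
  have h := standard_identity hm (fun i => wordProd A (f i))
  have key : ∀ σ : Equiv.Perm (Fin m),
      (List.ofFn ((fun i => wordProd A (f i)) ∘ σ)).prod =
        wordProd A (List.ofFn (f ∘ σ)).flatten := by
    intro σ
    rw [wordProd_flatten, List.map_ofFn]
    rfl
  simp only [key] at h
  rw [← Finset.add_sum_erase _ _ (Finset.mem_univ (1 : Equiv.Perm (Fin m))), map_one,
    one_smul, Equiv.Perm.coe_one, Function.comp_id] at h
  simp only [wordProd_append]
  rw [eq_neg_of_add_eq_zero_left h, ← Finset.sum_neg_distrib, Finset.mul_sum, Finset.sum_mul]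
  refine Finset.sum_congr rfl fun σ _ => ?_
  rw [neg_smul, Int.cast_smul_eq_zsmul, Units.smul_def, mul_neg, neg_mul, mul_smul_comm,
    smul_mul_assoc]

theorem append_lt_append_right [LinearOrder α] {a b : List α} (r : List α) (h : a < b)
    (hl : a.length = b.length) : a ++ r < b ++ r := by
  rcases lt_cases h with ⟨c, hc, rfl⟩ | ⟨p, s, t, a', b', rfl, rfl, hst⟩
  · simp at hl
    exact absurd hl hc
  · rw [List.append_assoc, List.append_assoc]
    exact append_lt_append_left _ (List.cons_lt_cons_iff.2 (Or.inl hst))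

theorem length_flatten_map {J : Type*} (v : J → List α) (μ : List J) {K : ℕ}
    (h : ∀ j ∈ μ, (v j).length = K) : (μ.map v).flatten.length = μ.length * K := by
  induction μ with
  | nil => simp
  | cons j μ ih =>
    simp only [List.map_cons, List.flatten_cons, List.length_append, List.length_cons]
    rw [ih fun i hi => h i (List.mem_cons_of_mem _ hi), h j List.mem_cons_self]
    ring

theorem length_flatten_map_lt {J : Type*} (v : J → List α) {μ : List J} (hμ : μ ≠ []) {K : ℕ}
    (h : ∀ j ∈ μ, (v j).length < K) : (μ.map v).flatten.length < μ.length * K := by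
  obtain ⟨j, μ, rfl⟩ := List.exists_cons_of_ne_nil hμ
  have h1 : (μ.map v).flatten.length ≤ μ.length * K := by
    have := length_flatten_le (K := K) (B := μ.map v) (by
      intro b hb
      obtain ⟨i, hi, rfl⟩ := List.mem_map.1 hb
      exact (h i (List.mem_cons_of_mem _ hi)).le)
    simpa using this
  have h2 := h j List.mem_cons_self
  simp only [List.map_cons, List.flatten_cons, List.length_append, List.length_cons, add_mul,
    one_mul]
  omega

/-- One step of the reduction of long words, when the word contains a large power. -/
theorem coeff_mem_of_pow [Nontrivial C] (A : α → Matrix ι ι C) {G : Subring C} {i : ℕ}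
    (hi : 0 < i) {p u r : List α} (hu : u ≠ [])
    (ih : ∀ (i' : ℕ) (w' : List α), i' * w'.length <
      i * (p ++ (List.replicate (Fintype.card ι + 1) u).flatten ++ r).length →
        (wordProd A w').charpolyRev.coeff i' ∈ G) :
    (wordProd A (p ++ (List.replicate (Fintype.card ι + 1) u).flatten ++ r)).charpolyRev.coeff i
      ∈ G := by
  set w := p ++ (List.replicate (Fintype.card ι + 1) u).flatten ++ r with hw
  have hu0 : 0 < u.length := List.length_pos_iff.2 hu
  have hwl : w.length = p.length + (Fintype.card ι + 1) * u.length + r.length := by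
    simp [hw, add_assoc]
  rw [hw, wordProd_pow]
  refine coeff_charpolyRev_sum_smul_mem G i _ _ _ fun μ hμ hs l hl hli => ⟨?_, ?_⟩
  · refine list_prod_map_mem fun j hj => neg_mem ?_
    have hj' := Finset.mem_range.1 (hs j hj)
    rw [charpolyRev_coeff_of_le _ hj'.le]
    refine ih _ _ ?_
    calc (Fintype.card ι - j) * u.length ≤ Fintype.card ι * u.length :=
          Nat.mul_le_mul_right _ (Nat.sub_le _ _)
      _ < w.length := by rw [hwl, add_mul]; omega
      _ ≤ i * w.length := Nat.le_mul_of_pos_left _ hi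
  · have h1 : (μ.map fun j => wordProd A (p ++ (List.replicate (j + 1) u).flatten ++ r)).prod =
        wordProd A (μ.map fun j => p ++ (List.replicate (j + 1) u).flatten ++ r).flatten := by
      rw [wordProd_flatten, List.map_map]
      rfl
    rw [h1]
    refine ih _ _ ?_
    have h2 := length_flatten_map_lt (K := w.length)
      (fun j => p ++ (List.replicate (j + 1) u).flatten ++ r) hμ (fun j hj => by
        have hj' := Finset.mem_range.1 (hs j hj)
        have : (j + 1) * u.length < (Fintype.card ι + 1) * u.length :=
          Nat.mul_lt_mul_of_pos_right (by omega) hu0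
        rw [hwl]
        simp
        omega)
    calc _ < l * (μ.length * w.length) := Nat.mul_lt_mul_of_pos_left h2 hl
      _ = (l * μ.length) * w.length := by ring
      _ ≤ i * w.length := Nat.mul_le_mul_right _ hli

/-- One step of the reduction of long words, when the word contains a divided factor. -/
theorem coeff_mem_of_isDivided [LinearOrder α] (A : α → Matrix ι ι C) {G : Subring C} {i : ℕ}
    {p r : List α} {ws : List (List α)} (hws : IsDivided ws)
    (hlen : Fintype.card ι * Fintype.card ι < ws.length)
    (ih : ∀ (i' : ℕ) (w' : List α), i' * w'.length < i * (p ++ ws.flatten ++ r).length →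
        (wordProd A w').charpolyRev.coeff i' ∈ G)
    (ih' : ∀ (i' : ℕ) (w' : List α), i' * w'.length = i * (p ++ ws.flatten ++ r).length →
      i' < i → (wordProd A w').charpolyRev.coeff i' ∈ G)
    (ih'' : ∀ w' : List α, w'.length = (p ++ ws.flatten ++ r).length →
      w' < p ++ ws.flatten ++ r → (wordProd A w').charpolyRev.coeff i ∈ G) :
    (wordProd A (p ++ ws.flatten ++ r)).charpolyRev.coeff i ∈ G := by
  obtain ⟨hnd, hne, hlt⟩ := hws
  obtain ⟨f, hf⟩ : ∃ f : Fin ws.length → List α, List.ofFn f = ws := ⟨ws.get, List.ofFn_get ws⟩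
  have hperm : ∀ σ : Equiv.Perm (Fin ws.length), (List.ofFn (f ∘ σ)).Perm ws := fun σ =>
    (Equiv.Perm.ofFn_comp_perm σ f).trans (.of_eq hf)
  set w := p ++ ws.flatten ++ r with hw
  have hvl : ∀ σ : Equiv.Perm (Fin ws.length),
      (p ++ (List.ofFn (f ∘ σ)).flatten ++ r).length = w.length := fun σ => by
    rw [hw, List.length_append, List.length_append, List.length_append, List.length_append,
      (hperm σ).flatten.length_eq]
  have hw0 : 0 < w.length := by
    obtain ⟨v, ws, rfl⟩ := List.exists_cons_of_length_pos (Nat.zero_lt_of_lt hlen)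
    have := List.length_pos_iff.2 (hne v List.mem_cons_self)
    simp [hw]
    omega
  have hexp := wordProd_perm A hlen f p r
  rw [hf, ← hw] at hexp
  rw [hexp]
  refine coeff_charpolyRev_sum_smul_mem G i _ _ _ fun μ hμ hs l hl hli => ⟨?_, ?_⟩
  · exact list_prod_map_mem fun j _ => neg_mem (intCast_mem G _)
  · have h1 : (μ.map fun σ : Equiv.Perm (Fin ws.length) =>
          wordProd A (p ++ (List.ofFn (f ∘ σ)).flatten ++ r)).prod =
        wordProd A (μ.map fun σ : Equiv.Perm (Fin ws.length) =>
          p ++ (List.ofFn (f ∘ σ)).flatten ++ r).flatten := by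
      rw [wordProd_flatten, List.map_map]
      rfl
    have h2 := length_flatten_map (K := w.length)
      (fun σ : Equiv.Perm (Fin ws.length) => p ++ (List.ofFn (f ∘ σ)).flatten ++ r) μ
      fun σ _ => hvl σ
    have hμ0 := List.length_pos_iff.2 hμ
    have hle : l ≤ l * μ.length := Nat.le_mul_of_pos_right _ hμ0
    rw [h1]
    rcases hli.lt_or_eq with hlt' | heq
    · refine ih _ _ ?_
      rw [h2, ← mul_assoc]
      exact Nat.mul_lt_mul_of_pos_right hlt' hw0
    · rcases (hle.trans hli).lt_or_eq with hl' | rfl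
      · refine ih' _ _ ?_ hl'
        rw [h2, ← mul_assoc, heq]
      · have hμ1 : μ.length = 1 := Nat.eq_of_mul_eq_mul_left hl (by rw [heq, mul_one])
        obtain ⟨σ, rfl⟩ := List.length_eq_one_iff.1 hμ1
        simp only [List.map_cons, List.map_nil, List.flatten_cons, List.flatten_nil,
          List.append_nil]
        refine ih'' _ (hvl σ) ?_
        have hσ : List.ofFn (f ∘ σ) ≠ ws := by
          intro h
          have h3 := List.ofFn_injective (h.trans hf.symm)
          have h4 : Function.Injective f := List.nodup_ofFn.1 (hf.symm ▸ hnd)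
          refine Finset.ne_of_mem_erase (hs σ List.mem_cons_self) (Equiv.ext fun x => ?_)
          exact h4 (congrFun h3 x)
        rw [hw, List.append_assoc, List.append_assoc]
        exact append_lt_append_left _ (append_lt_append_right _ (hlt _ (hperm σ) hσ)
          (hperm σ).flatten.length_eq)

/-- Over a finite alphabet, the coefficients of the characteristic polynomials of all words belong
to any subring that contains those of the words of bounded length. The proof is by induction on
the degree `i * w.length`, then on `i`, then on the word in lexicographic order. -/
theorem exists_length_coeff_mem [LinearOrder α] [Fintype α] (A : α → Matrix ι ι C) :
    ∃ L, ∀ G : Subring C,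
      (∀ w : List α, w.length < L → ∀ i, (wordProd A w).charpolyRev.coeff i ∈ G) →
        ∀ (w : List α) (i : ℕ), (wordProd A w).charpolyRev.coeff i ∈ G := by
  rcases subsingleton_or_nontrivial C with hC | hC
  · exact ⟨0, fun G _ w i => by rw [Subsingleton.elim ((wordProd A w).charpolyRev.coeff i) 0]
                                exact zero_mem G⟩
  obtain ⟨L, hL⟩ := exists_pow_or_isDivided (q := Fintype.card ι + 1) (Nat.succ_pos _)
    (Fintype.card ι * Fintype.card ι + 1) (Finset.univ : Finset α)
  refine ⟨L, fun G hG => ?_⟩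
  suffices key : ∀ D i : ℕ, ∀ w : List α, i * w.length = D →
      (wordProd A w).charpolyRev.coeff i ∈ G from fun w i => key _ i w rfl
  intro D
  induction D using Nat.strong_induction_on with
  | _ D ihD =>
    intro i
    induction i using Nat.strong_induction_on with
    | _ i ihi =>
      intro w
      obtain ⟨K, hK⟩ : ∃ K, w.length = K := ⟨_, rfl⟩
      have hfin : Finite {w : List α // w.length = K} :=
        (List.finite_length_eq α K).to_subtype
      have hwf : WellFounded fun v w : {w : List α // w.length = K} => v < w := wellFounded_lt
      suffices key : ∀ w : {w : List α // w.length = K}, i * w.1.length = D →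
          (wordProd A w.1).charpolyRev.coeff i ∈ G from key ⟨w, hK⟩
      intro w
      induction w using hwf.induction with
      | _ w ihw =>
        obtain ⟨w, hw⟩ := w
        intro hwD
        simp only at hwD ihw ⊢
        rcases Nat.eq_zero_or_pos i with rfl | hi
        · rw [coeff_charpolyRev_zero]
          exact one_mem G
        rcases lt_or_ge w.length L with hlt | hge
        · exact hG w hlt i
        rcases hL w (fun _ _ => Finset.mem_univ _) hge with
          ⟨u, hu, p, r, rfl⟩ | ⟨ws, hlen, hdiv, p, r, rfl⟩
        · exact coeff_mem_of_pow A hi hu fun i' w' h => ihD _ (hwD ▸ h) i' w' rfl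
        · refine coeff_mem_of_isDivided A hdiv (by omega)
            (fun i' w' h => ihD _ (hwD ▸ h) i' w' rfl)
            (fun i' w' h hi' => ihi i' hi' w' (h.trans hwD)) fun w' hl hlt => ?_
          exact ihw ⟨w', hl.trans hw⟩ hlt (by rw [hl, hwD])

theorem exists_eq_sum_wordProd {k : Type*} [CommRing k] [Algebra k C] (A : α → Matrix ι ι C)
    {x : Matrix ι ι C} (hx : x ∈ Algebra.adjoin k (Set.range A)) :
    ∃ (m : ℕ) (c : Fin m → k) (w : Fin m → List α), x = ∑ j, c j • wordProd A (w j) := by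
  rw [← Subalgebra.mem_toSubmodule, Algebra.adjoin_eq_span, Submodule.mem_span_set'] at hx
  obtain ⟨m, c, g, rfl⟩ := hx
  have : ∀ j, ∃ w, (g j : Matrix ι ι C) = wordProd A w := by
    intro j
    obtain ⟨l, hl, h⟩ := Submonoid.exists_list_of_mem_closure (g j).2
    have h2 : ∃ w : List α, w.map A = l := by
      clear h
      induction l with
      | nil => exact ⟨[], rfl⟩
      | cons y l ih =>
        obtain ⟨a, rfl⟩ := hl y List.mem_cons_self
        obtain ⟨w, rfl⟩ := ih fun z hz => hl z (List.mem_cons_of_mem _ hz)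
        exact ⟨a :: w, rfl⟩
    obtain ⟨w, rfl⟩ := h2
    exact ⟨w, h.symm⟩
  choose w hw using this
  exact ⟨m, c, w, Finset.sum_congr rfl fun j _ => by rw [hw]⟩

/-- For finitely many matrices over a commutative `k`-algebra, the `k`-algebra generated by the
coefficients of the characteristic polynomials of all elements of the `k`-algebra that the matrices
generate is finitely generated. -/
theorem fg_adjoin_coeff_charpoly {k : Type*} [CommRing k] [Algebra k C] [LinearOrder α]
    [Fintype α] (A : α → Matrix ι ι C) :
    (Algebra.adjoin k {c | ∃ x ∈ Algebra.adjoin k (Set.range A), ∃ i : ℕ,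
      c = x.charpoly.coeff i}).FG := by
  rcases subsingleton_or_nontrivial C with hC | hC
  · have : ∀ S : Subalgebra k C, S = ⊥ := fun S =>
      le_antisymm (fun x _ => by rw [Subsingleton.elim x 0]; exact zero_mem _) bot_le
    rw [this (Algebra.adjoin k _)]
    exact Subalgebra.fg_bot
  obtain ⟨L, hL⟩ := exists_length_coeff_mem A
  let S : Set C := (fun p : List α × ℕ => (wordProd A p.1).charpolyRev.coeff p.2) ''
    ({w : List α | w.length ≤ L} ×ˢ Set.Iic (Fintype.card ι))
  have hS : S.Finite := ((List.finite_length_le α L).prod (Set.finite_Iic _)).image _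
  refine Subalgebra.fg_def.2 ⟨S, hS, le_antisymm (Algebra.adjoin_le ?_) (Algebra.adjoin_le ?_)⟩
  · rintro _ ⟨⟨w, i⟩, ⟨-, hi⟩, rfl⟩
    refine Algebra.subset_adjoin ⟨wordProd A w, ?_, Fintype.card ι - i, ?_⟩
    · exact list_prod_mem fun x hx => by
        obtain ⟨a, -, rfl⟩ := List.mem_map.1 hx
        exact Algebra.subset_adjoin ⟨a, rfl⟩
    · rw [charpolyRev_coeff_of_le _ (Nat.sub_le _ _), Nat.sub_sub_self hi]
  · rintro _ ⟨x, hx, i, rfl⟩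
    have hw := hL (Algebra.adjoin k S).toSubring fun w hw i => by
      rcases le_or_gt i (Fintype.card ι) with hi | hi
      · exact Algebra.subset_adjoin ⟨(w, i), ⟨hw.le, hi⟩, rfl⟩
      · rw [charpolyRev_coeff_eq_zero _ hi]
        exact zero_mem _
    rcases le_or_gt i (Fintype.card ι) with hi | hi
    · obtain ⟨m, c, w, rfl⟩ := exists_eq_sum_wordProd A hx
      rw [charpolyRev_coeff_of_le _ hi]
      have := coeff_charpolyRev_sum_smul_mem (Algebra.adjoin k S).toSubring
        (Fintype.card ι - i) Finset.univ (fun j => algebraMap k C (c j))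
        (fun j => wordProd A (w j)) fun μ _ _ l _ _ => ⟨?_, ?_⟩
      · simp only [algebraMap_smul] at this
        exact this
      · exact list_prod_map_mem fun j _ => Subalgebra.algebraMap_mem _ _
      · have h1 : (μ.map fun j => wordProd A (w j)).prod = wordProd A (μ.map w).flatten := by
          rw [wordProd_flatten, List.map_map]
          rfl
        rw [h1]
        exact hw _ _
    · rw [Polynomial.coeff_eq_zero_of_natDegree_lt
        (by rwa [Matrix.charpoly_natDegree_eq_dim])]
      exact zero_mem _

end Words

/-! ### Irreducible representations and their characteristic polynomials -/

section Irreducible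

variable {k : Type u} [Field k]

/-- **Burnside's theorem**: over an algebraically closed field, the only irreducible algebra of
endomorphisms of a finite-dimensional vector space is the algebra of all endomorphisms. This
follows from the density theorem and from Schur's lemma, by which the commutant is `k`. -/
theorem eq_top_of_isSimpleModule [IsAlgClosed k] {V : Type*} [AddCommGroup V] [Module k V]
    [FiniteDimensional k V] (A : Subalgebra k (Module.End k V)) [IsSimpleModule A V] : A = ⊤ := by
  have hV : Nontrivial V := IsSimpleModule.nontrivial A V
  have hschur : ∀ h : Module.End A V, ∃ c : k, ∀ v, h v = c • v := by
    intro h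
    let h' : Module.End k V := h.restrictScalars k
    obtain ⟨c, hc⟩ := Module.End.exists_eigenvalue h'
    obtain ⟨v, hv⟩ := hc.exists_hasEigenvector
    have hcomm : ∀ (a : A) (w : V), a • c • w = c • a • w := fun a w => by
      exact map_smul (a : Module.End k V) c w
    let g : Module.End A V :=
      { toFun := fun w => h w - c • w
        map_add' := fun x y => by simp only [map_add, smul_add]; abel
        map_smul' := fun a x => by
          simp only [map_smul, RingHom.id_apply, smul_sub, hcomm] }
    have hg : g = 0 := by
      refine (LinearMap.bijective_or_eq_zero g).resolve_left fun hbij => hv.2 (hbij.1 ?_)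
      rw [map_zero]
      change h v - c • v = 0
      rw [sub_eq_zero]
      exact hv.apply_eq_smul
    refine ⟨c, fun w => ?_⟩
    have := congrArg (fun f : Module.End A V => f w) hg
    exact sub_eq_zero.1 this
  refine eq_top_iff.2 fun f _ => ?_
  let F : Module.End (Module.End A V) V :=
    { toFun := f
      map_add' := map_add f
      map_smul' := fun h v => by
        obtain ⟨c, hc⟩ := hschur h
        simp only [Module.End.smul_def, RingHom.id_apply, hc, map_smul] }
  let b := Module.finBasis k V
  classical
  obtain ⟨a, ha⟩ := jacobson_density F (Finset.univ.image b)
  have : f = (a : Module.End k V) := b.ext fun i =>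
    ha (b i) (Finset.mem_image_of_mem _ (Finset.mem_univ i))
  exact this ▸ a.2

variable {R : Type u} [Ring R] [Algebra k R]

theorem IsIrreducibleRep.surjective [IsAlgClosed k] {m : ℕ}
    {ρ : R →ₐ[k] Matrix (Fin m) (Fin m) k} (h : IsIrreducibleRep ρ) : Function.Surjective ρ := by
  let φ : R →ₐ[k] Module.End k (Fin m → k) :=
    (Matrix.toLinAlgEquiv' : Matrix (Fin m) (Fin m) k ≃ₐ[k] _).toAlgHom.comp ρ
  have hφ : ∀ r v, φ r v = (ρ r).mulVec v := fun r v => rfl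
  have : NeZero m := ⟨h.1.ne'⟩
  have hsimple : IsSimpleModule φ.range (Fin m → k) := by
    refine { eq_bot_or_eq_top := fun W => ?_ }
    have hW := h.2 (W.restrictScalars k) fun r w hw =>
      W.smul_mem (⟨φ r, r, rfl⟩ : φ.range) hw
    rcases hW with h0 | h0
    · exact Or.inl ((Submodule.restrictScalars_eq_bot_iff ..).1 h0)
    · exact Or.inr ((Submodule.restrictScalars_eq_top_iff ..).1 h0)
  have htop := eq_top_of_isSimpleModule φ.range
  intro M
  have : Matrix.toLinAlgEquiv' M ∈ φ.range := htop ▸ Algebra.mem_top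
  obtain ⟨r, hr⟩ := this
  exact ⟨r, (Matrix.toLinAlgEquiv' : Matrix (Fin m) (Fin m) k ≃ₐ[k] _).injective hr⟩

/-- Irreducible representations with the same kernel are equivalent. An intertwiner sends a vector
`w` to `σ r v`, where `r` is an element such that `ρ r` has `w` as its first column and no other
nonzero column. It does not depend on `r`, as the kernels agree, and it is nonzero for a suitable
vector `v`. -/
theorem IsIrreducibleRep.exists_equiv [IsAlgClosed k] {m m' : ℕ}
    {ρ : R →ₐ[k] Matrix (Fin m) (Fin m) k} {σ : R →ₐ[k] Matrix (Fin m') (Fin m') k}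
    (hρ : IsIrreducibleRep ρ) (hσ : IsIrreducibleRep σ) (hker : ∀ r, ρ r = 0 ↔ σ r = 0) :
    ∃ e : (Fin m → k) ≃ₗ[k] (Fin m' → k),
      ∀ r w, e ((ρ r).mulVec w) = (σ r).mulVec (e w) := by
  let z : Fin m := ⟨0, hρ.1⟩
  choose y hy using fun j => hρ.surjective (Matrix.single j z (1 : k))
  have hy0 : σ (y z) ≠ 0 := fun h => by
    have := (hker _).2 h
    rw [hy] at this
    simpa using congrFun (congrFun this z) z
  obtain ⟨v, hv⟩ : ∃ v, (σ (y z)).mulVec v ≠ 0 := by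
    by_contra! h
    refine hy0 (Matrix.ext_of_mulVec_single fun i => ?_)
    rw [h, Matrix.zero_mulVec]
  let T : (Fin m → k) →ₗ[k] (Fin m' → k) :=
    Fintype.linearCombination k fun j => (σ (y j)).mulVec v
  have hT : ∀ w, T w = (σ (∑ j, w j • y j)).mulVec v := fun w => by
    rw [Fintype.linearCombination_apply, map_sum, Matrix.sum_mulVec]
    exact Finset.sum_congr rfl fun j _ => by rw [map_smul, Matrix.smul_mulVec]
  have hρy : ∀ (w : Fin m → k) (i j : Fin m),
      ρ (∑ l, w l • y l) i j = if j = z then w i else 0 := fun w i j => by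
    rw [map_sum, Matrix.sum_apply]
    simp only [map_smul, hy, Matrix.smul_apply, Matrix.single_apply, smul_eq_mul]
    rcases eq_or_ne j z with rfl | hj
    · simp
    · simp [hj, hj.symm]
  have hcomm : ∀ r w, T ((ρ r).mulVec w) = (σ r).mulVec (T w) := fun r w => by
    rw [hT, hT, Matrix.mulVec_mulVec, ← map_mul, ← sub_eq_zero, ← Matrix.sub_mulVec, ← map_sub]
    have : σ (∑ j, (ρ r).mulVec w j • y j - r * ∑ j, w j • y j) = 0 := by
      refine (hker _).1 (Matrix.ext fun i j => ?_)
      rw [map_sub, map_mul, Matrix.sub_apply, hρy, Matrix.mul_apply]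
      simp only [hρy]
      split_ifs <;> simp [Matrix.mulVec, dotProduct]
    rw [this, Matrix.zero_mulVec]
  have hTz : T (Pi.single z 1) ≠ 0 := by
    have : T (Pi.single z 1) = (σ (y z)).mulVec v := by
      rw [Fintype.linearCombination_apply, Finset.sum_eq_single z] <;> simp +contextual
    rwa [this]
  have hinj : LinearMap.ker T = ⊥ := by
    refine (hρ.2 (LinearMap.ker T) fun r w hw => ?_).resolve_right fun h => hTz ?_
    · rw [LinearMap.mem_ker] at hw ⊢
      rw [hcomm, hw, Matrix.mulVec_zero]
    · rw [← LinearMap.mem_ker, h]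
      trivial
  have hsurj : LinearMap.range T = ⊤ := by
    refine (hσ.2 (LinearMap.range T) fun r w hw => ?_).resolve_left fun h => hTz ?_
    · obtain ⟨w, rfl⟩ := hw
      exact ⟨_, hcomm r w⟩
    · rw [← Submodule.mem_bot k, ← h]
      exact ⟨_, rfl⟩
  exact ⟨LinearEquiv.ofBijective T ⟨LinearMap.ker_eq_bot.1 hinj, LinearMap.range_eq_top.1 hsurj⟩,
    hcomm⟩

theorem charpoly_eq_of_equiv {m m' : ℕ} {ρ : R →ₐ[k] Matrix (Fin m) (Fin m) k}
    {σ : R →ₐ[k] Matrix (Fin m') (Fin m') k} (e : (Fin m → k) ≃ₗ[k] (Fin m' → k))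
    (he : ∀ r w, e ((ρ r).mulVec w) = (σ r).mulVec (e w)) (r : R) :
    (ρ r).charpoly = (σ r).charpoly := by
  rw [← Matrix.charpoly_toLin' (ρ r), ← Matrix.charpoly_toLin' (σ r), ← e.charpoly_conj]
  congr 1
  refine LinearMap.ext fun w => ?_
  rw [LinearEquiv.conj_apply_apply, Matrix.toLin'_apply, he, e.apply_symm_apply,
    Matrix.toLin'_apply]

theorem charpoly_blockDiagonal {m o : ℕ} (M : Matrix (Fin m) (Fin m) k) :
    (Matrix.blockDiagonal fun _ : Fin o => M).charpoly = M.charpoly ^ o := by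
  have h : (Matrix.blockDiagonal fun _ : Fin o => M).charmatrix =
      Matrix.blockDiagonal fun _ : Fin o => M.charmatrix := by
    ext ⟨i, a⟩ ⟨j, b⟩ : 1
    rcases eq_or_ne a b with rfl | hab
    · simp [Matrix.charmatrix_apply, Matrix.blockDiagonal_apply, Matrix.diagonal_apply]
    · simp [Matrix.blockDiagonal_apply, hab]
  rw [Matrix.charpoly, h, Matrix.det_blockDiagonal]
  simp [Matrix.charpoly]

theorem charpoly_diagRep {m N : ℕ} (hm : m ∣ N) (ρ : R →ₐ[k] Matrix (Fin m) (Fin m) k) (r : R) :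
    (diagRep hm ρ r).charpoly = (ρ r).charpoly ^ (N / m) := by
  rw [← charpoly_blockDiagonal]
  exact Matrix.charpoly_reindex _ _

theorem diagRep_eq_zero {m N : ℕ} (hm : m ∣ N) {ρ : R →ₐ[k] Matrix (Fin m) (Fin m) k} {r : R}
    (h : ρ r = 0) : diagRep hm ρ r = 0 := by
  have : (fun _ : Fin (N / m) => ρ r) = 0 := funext fun _ => h
  change Matrix.reindex _ _ (Matrix.blockDiagonal fun _ => ρ r) = 0
  rw [this, Matrix.blockDiagonal_zero]
  rfl

theorem diagRep_eq_one {m N : ℕ} (hm : m ∣ N) {ρ : R →ₐ[k] Matrix (Fin m) (Fin m) k} {r : R}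
    (h : ρ r = 1) : diagRep hm ρ r = 1 := by
  rw [← map_one (diagRep hm ρ)]
  change Matrix.reindex _ _ (Matrix.blockDiagonal fun _ => ρ r) =
    Matrix.reindex _ _ (Matrix.blockDiagonal fun _ => ρ 1)
  rw [h, map_one]

/-- A two-sided ideal not contained in the kernel of an irreducible representation contains an
element represented by the identity matrix, because the algebra of matrices is simple. -/
theorem exists_mem_map_eq_one {m : ℕ} {ρ : R →ₐ[k] Matrix (Fin m) (Fin m) k}
    (hρ : Function.Surjective ρ) (I : TwoSidedIdeal R) {a : R} (ha : a ∈ I) (ha0 : ρ a ≠ 0) :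
    ∃ r ∈ I, ρ r = 1 := by
  obtain ⟨i, j, hij⟩ : ∃ i j, ρ a i j ≠ 0 := by
    by_contra! h
    exact ha0 (Matrix.ext h)
  choose x hx using fun l => hρ (Matrix.single l i (1 : k))
  choose y hy using fun l => hρ (Matrix.single j l (ρ a i j)⁻¹)
  refine ⟨∑ l, x l * a * y l, sum_mem fun l _ =>
    I.mul_mem_right _ _ (I.mul_mem_left _ _ ha), ?_⟩
  rw [map_sum]
  have : ∀ l, ρ (x l * a * y l) = Matrix.single l l 1 := fun l => by
    rw [map_mul, map_mul, hx, hy, Matrix.single_mul_mul_single]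
    simp [hij]
  simp only [this]
  exact Matrix.sum_single_one

end Irreducible

/-! ### The map from primitive ideals to maximal ideals -/

section TraceRing

variable {k : Type u} [Field k] {s : ℕ} {rels : Set (FreeAlgebra k (Fin s))} {N : ℕ}

/-- The `i`-th coefficient of the characteristic polynomial of `π(r)`, as an element of `T`. -/
noncomputable def charCoeff (rels : Set (FreeAlgebra k (Fin s))) (N : ℕ) (r : Alg rels) (i : ℕ) :
    traceRing rels N :=
  ⟨(piHom rels N r).charpoly.coeff i, Algebra.subset_adjoin ⟨r, i, rfl⟩⟩

theorem tildeT_charCoeff (ρ : Alg rels →ₐ[k] Matrix (Fin N) (Fin N) k) (r : Alg rels) (i : ℕ) :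
    tildeT ρ (charCoeff rels N r i) = (ρ r).charpoly.coeff i := by
  have h : ((piHom rels N r).map (tildeC ρ).toRingHom).charpoly = (ρ r).charpoly :=
    congrArg Matrix.charpoly (tilde_piHom ρ r)
  rw [Matrix.charpoly_map] at h
  rw [← h, Polynomial.coeff_map]
  rfl

/-- The algebra `T` is generated by coefficients of characteristic polynomials, so these determine
the homomorphism from `T` to `k` induced by a representation. -/
theorem tildeT_eq {ρ σ : Alg rels →ₐ[k] Matrix (Fin N) (Fin N) k}
    (h : ∀ r, (ρ r).charpoly = (σ r).charpoly) : tildeT ρ = tildeT σ := by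
  refine AlgHom.adjoin_ext ?_
  rintro _ ⟨r, i, rfl⟩
  have := tildeT_charCoeff ρ r i
  rw [h, ← tildeT_charCoeff σ r i] at this
  exact this

theorem tildeT_diagRep_eq [IsAlgClosed k] {m m' : ℕ} (hm : m ∣ N) (hm' : m' ∣ N)
    {ρ : Alg rels →ₐ[k] Matrix (Fin m) (Fin m) k} {σ : Alg rels →ₐ[k] Matrix (Fin m') (Fin m') k}
    (hρ : IsIrreducibleRep ρ) (hσ : IsIrreducibleRep σ)
    (hker : TwoSidedIdeal.ker ρ = TwoSidedIdeal.ker σ) :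
    tildeT (diagRep hm ρ) = tildeT (diagRep hm' σ) := by
  obtain ⟨e, he⟩ := hρ.exists_equiv hσ fun r => by
    rw [← TwoSidedIdeal.mem_ker, hker, TwoSidedIdeal.mem_ker]
  have hmm : m = m' := by
    have := e.finrank_eq
    simpa using this
  subst hmm
  exact tildeT_eq fun r => by
    rw [charpoly_diagRep, charpoly_diagRep, charpoly_eq_of_equiv e he]

/-- A `k`-algebra homomorphism to `k` is determined by its kernel. -/
theorem algHom_eq_of_ker_eq {T : Type*} [CommRing T] [Algebra k T] {f g : T →ₐ[k] k}
    (h : RingHom.ker f = RingHom.ker g) : f = g := by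
  refine AlgHom.ext fun t => ?_
  have h1 : t - algebraMap k T (f t) ∈ RingHom.ker f := by
    rw [RingHom.mem_ker, map_sub, AlgHom.commutes]
    exact sub_self _
  rw [h, RingHom.mem_ker, map_sub, AlgHom.commutes, sub_eq_zero] at h1
  exact h1.symm

theorem scalar_charpoly_coeff_zero {C : Type*} [CommRing C] (M : Matrix (Fin N) (Fin N) C) :
    Matrix.scalar (Fin N) (M.charpoly.coeff 0) = M * ((-1 : C) ^ N • M.adjugate) := by
  rw [mul_smul_comm, Matrix.mul_adjugate, Matrix.det_eq_sign_charpoly_coeff M, smul_smul,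
    Fintype.card_fin, ← mul_assoc, ← mul_pow, neg_one_mul, neg_neg, one_pow, one_mul,
    Matrix.smul_one_eq_diagonal]
  rfl

/-- The scalar matrix `det π(r)`, for `r` in `I`, belongs to `M π(I) M`, since it is the product of
`π(r)` with its adjugate. -/
theorem charCoeff_zero_mem_contraction {I : TwoSidedIdeal (Alg rels)} {r : Alg rels}
    (hr : r ∈ I) : charCoeff rels N r 0 ∈ contraction rels N I := by
  refine TwoSidedIdeal.mem_asIdeal.2 ((TwoSidedIdeal.mem_comap _).2 ?_)
  have h : traceRingToM rels N (charCoeff rels N r 0) =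
      piHom rels N r * ((-1 : CRing rels N) ^ N • (piHom rels N r).adjugate) :=
    scalar_charpoly_coeff_zero _
  rw [h]
  exact TwoSidedIdeal.mul_mem_right _ _ _ (TwoSidedIdeal.subset_span ⟨r, hr, rfl⟩)

theorem traceRing_fg : (traceRing rels N).FG := by
  have hrange : (piHom rels N).range = Algebra.adjoin k
      (Set.range fun l : Fin s => piHom rels N (proj rels (FreeAlgebra.ι k l))) := by
    have h1 : (piHom rels N).range = ((piHom rels N).comp (proj rels)).range := by
      have h2 : (proj rels).range = ⊤ :=
        (AlgHom.range_eq_top _).2 (RingQuot.mkAlgHom_surjective k _)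
      rw [AlgHom.range_comp, h2, Algebra.map_top]
    rw [h1, ← Algebra.map_top, ← FreeAlgebra.adjoin_range_ι, AlgHom.map_adjoin, ← Set.range_comp]
    rfl
  have h := fg_adjoin_coeff_charpoly (k := k)
    fun l : Fin s => piHom rels N (proj rels (FreeAlgebra.ι k l))
  rw [← hrange] at h
  have hset : {c | ∃ x ∈ (piHom rels N).range, ∃ i : ℕ, c = x.charpoly.coeff i} =
      {c | ∃ (r : Alg rels) (i : ℕ), c = (piHom rels N r).charpoly.coeff i} := by
    ext c
    constructor
    · rintro ⟨_, ⟨r, rfl⟩, i, h⟩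
      exact ⟨r, i, h⟩
    · rintro ⟨r, i, h⟩
      exact ⟨_, ⟨r, rfl⟩, i, h⟩
  rw [hset] at h
  exact h

end TraceRing

theorem isClosed_maxHull {T : Type*} [CommRing T] (J : Ideal T) : IsClosed (maxHull J) :=
  (PrimeSpectrum.isClosed_zeroLocus (J : Set T)).preimage
    MaximalSpectrum.toPrimeSpectrum_continuous

theorem rangeFactorization_image_preimage {X Y : Type*} (f : X → Y) (W : Set Y) :
    Set.rangeFactorization f '' (f ⁻¹' W) = Subtype.val ⁻¹' W := by
  ext ⟨_, x, rfl⟩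
  constructor
  · rintro ⟨x', hx', h⟩
    rw [← h]
    exact hx'
  · intro h
    exact ⟨x, h, rfl⟩

theorem isClosed_zeros {k : Type u} [Field k] {q : ℕ} (S : Set (MvPolynomial (Fin q) k)) : IsClosed (zeros S) := by
  rw [← isOpen_compl_iff]
  change (zeros S)ᶜᶜ ∈ Set.range zeros
  exact ⟨S, (compl_compl _).symm⟩

section Psi

variable {k : Type u} [Field k] {s : ℕ} {rels : Set (FreeAlgebra k (Fin s))}
  {d N : ℕ} (hirr : IrrepDimLE k (Alg rels) d) (hdvd : ∀ m, 1 ≤ m → m ≤ d → m ∣ N)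

theorem exists_rep (P : Prim (Alg rels)) :
    ∃ (m : ℕ) (hm : m ∣ N) (ρ : Alg rels →ₐ[k] Matrix (Fin m) (Fin m) k),
      IsIrreducibleRep ρ ∧ TwoSidedIdeal.ker ρ = P.ideal ∧
        gammaN rels hirr hdvd P = tildeT (diagRep hm ρ) := by
  have h := (exists_irreducibleRep hirr P).choose_spec.choose_spec
  exact ⟨_, hdvd _ h.1.1 h.1.2, _, h.2.1, h.2.2, rfl⟩

theorem eval_coordMap {q : ℕ} (t : Fin q → traceRing rels N) (P : Prim (Alg rels))
    (f : MvPolynomial (Fin q) k) :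
    MvPolynomial.eval (coordMap rels hirr hdvd t P) f =
      gammaN rels hirr hdvd P (MvPolynomial.aeval t f) := by
  have h : MvPolynomial.aeval (fun i => gammaN rels hirr hdvd P (t i)) =
      (gammaN rels hirr hdvd P).comp (MvPolynomial.aeval t) := by
    refine MvPolynomial.algHom_ext fun i => ?_
    rw [MvPolynomial.aeval_X, AlgHom.comp_apply, MvPolynomial.aeval_X]
  rw [← AlgHom.comp_apply, ← h]
  rfl

variable [IsAlgClosed k]

theorem gammaN_eq (P : Prim (Alg rels)) {m : ℕ} (hm : m ∣ N)
    {ρ : Alg rels →ₐ[k] Matrix (Fin m) (Fin m) k} (hρ : IsIrreducibleRep ρ)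
    (hker : TwoSidedIdeal.ker ρ = P.ideal) :
    gammaN rels hirr hdvd P = tildeT (diagRep hm ρ) := by
  obtain ⟨m', hm', σ, hσ, hσk, h⟩ := exists_rep hirr hdvd P
  rw [h]
  exact tildeT_diagRep_eq hm' hm hσ hρ (hσk.trans hker.symm)

/-- If `r` acts as `0` at `P` and as `1` at `Q`, the determinant of `π(r)` separates the images of
`P` and `Q`. -/
theorem le_of_gammaN_eq (hN : 0 < N) {P Q : Prim (Alg rels)}
    (h : gammaN rels hirr hdvd P = gammaN rels hirr hdvd Q) : P.ideal ≤ Q.ideal := by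
  obtain ⟨m, hm, ρ, hρ, hρk, hP⟩ := exists_rep hirr hdvd P
  obtain ⟨m', hm', σ, hσ, hσk, hQ⟩ := exists_rep hirr hdvd Q
  intro a ha
  rw [← hσk, TwoSidedIdeal.mem_ker]
  by_contra ha0
  obtain ⟨r, hr, hr1⟩ := exists_mem_map_eq_one hσ.surjective P.ideal ha ha0
  rw [← hρk, TwoSidedIdeal.mem_ker] at hr
  have h1 := DFunLike.congr_fun h (charCoeff rels N r 0)
  rw [hP, hQ, tildeT_charCoeff, tildeT_charCoeff, diagRep_eq_zero hm hr, diagRep_eq_one hm' hr1]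
    at h1
  have : NeZero N := ⟨hN.ne'⟩
  have h2 := Matrix.det_eq_sign_charpoly_coeff (0 : Matrix (Fin N) (Fin N) k)
  rw [h1, ← Matrix.det_eq_sign_charpoly_coeff, Matrix.det_one,
    Matrix.det_zero] at h2
  exact zero_ne_one h2

theorem gammaN_injective (hN : 0 < N) : Function.Injective (gammaN rels hirr hdvd) :=
  fun _ _ h => Subtype.ext
    (le_antisymm (le_of_gammaN_eq hirr hdvd hN h) (le_of_gammaN_eq hirr hdvd hN h.symm))

theorem Psi_injective (hN : 0 < N) : Function.Injective (Psi rels hirr hdvd) :=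
  fun _ _ h => gammaN_injective hirr hdvd hN
    (algHom_eq_of_ker_eq (congrArg MaximalSpectrum.asIdeal h))

theorem contraction_le_iff (hN : 0 < N) (I : TwoSidedIdeal (Alg rels)) (P : Prim (Alg rels)) :
    contraction rels N I ≤ RingHom.ker (gammaN rels hirr hdvd P) ↔ I ≤ P.ideal := by
  obtain ⟨m, hm, ρ, hρ, hρk, hP⟩ := exists_rep hirr hdvd P
  have : NeZero N := ⟨hN.ne'⟩
  constructor
  · intro h a ha
    rw [← hρk, TwoSidedIdeal.mem_ker]
    by_contra ha0
    obtain ⟨r, hr, hr1⟩ := exists_mem_map_eq_one hρ.surjective I ha ha0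
    have h1 := h (charCoeff_zero_mem_contraction hr)
    rw [RingHom.mem_ker, hP, tildeT_charCoeff, diagRep_eq_one hm hr1] at h1
    have h2 := Matrix.det_eq_sign_charpoly_coeff (1 : Matrix (Fin N) (Fin N) k)
    rw [h1, Matrix.det_one, mul_zero] at h2
    exact one_ne_zero h2
  · intro h t ht
    have hspan : TwoSidedIdeal.span (piHom rels N '' (I : Set (Alg rels))) ≤
        TwoSidedIdeal.ker (tilde (diagRep hm ρ)) := by
      rw [TwoSidedIdeal.span_le]
      rintro _ ⟨r, hr, rfl⟩
      have hr' : r ∈ TwoSidedIdeal.ker ρ := hρk ▸ h hr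
      rw [SetLike.mem_coe, TwoSidedIdeal.mem_ker, tilde_piHom]
      exact diagRep_eq_zero hm ((TwoSidedIdeal.mem_ker _).1 hr')
    have h1 := hspan ((TwoSidedIdeal.mem_comap _).1 (TwoSidedIdeal.mem_asIdeal.1 ht))
    rw [TwoSidedIdeal.mem_ker] at h1
    have h2 := congrFun (congrFun h1 0) 0
    rw [RingHom.mem_ker, hP]
    have h3 : tildeC (diagRep hm ρ) (traceRingToM rels N t 0 0) = 0 := h2
    rw [traceRingToM, RingHom.comp_apply, Matrix.scalar_apply, Matrix.diagonal_apply_eq] at h3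
    exact h3

theorem preimage_maxHull (hN : 0 < N) (I : TwoSidedIdeal (Alg rels)) :
    Psi rels hirr hdvd ⁻¹' maxHull (contraction rels N I) = primHull I :=
  Set.ext fun P => contraction_le_iff hirr hdvd hN I P

theorem isClosedMap_Psi (hN : 0 < N) :
    IsClosedMap (Set.rangeFactorization (Psi rels hirr hdvd)) := by
  intro Z hZ
  obtain ⟨I, rfl⟩ := isClosed_prim_iff.1 hZ
  rw [← preimage_maxHull hirr hdvd hN, rangeFactorization_image_preimage]
  exact (isClosed_maxHull _).preimage continuous_subtype_val

theorem isOpenMap_Psi (hN : 0 < N) :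
    IsOpenMap (Set.rangeFactorization (Psi rels hirr hdvd)) := by
  intro U hU
  obtain ⟨I, hI⟩ := isClosed_prim_iff.1 (isClosed_compl_iff.2 hU)
  rw [← compl_compl U, ← hI, ← preimage_maxHull hirr hdvd hN, ← Set.preimage_compl,
    rangeFactorization_image_preimage]
  exact (isClosed_maxHull _).isOpen_compl.preimage continuous_subtype_val

theorem coordMap_injective (hN : 0 < N) {q : ℕ} {t : Fin q → traceRing rels N}
    (ht : Algebra.adjoin k (Set.range t) = ⊤) :
    Function.Injective (coordMap rels hirr hdvd t) := by
  intro P Q h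
  refine gammaN_injective hirr hdvd hN (AlgHom.ext_of_adjoin_eq_top ht ?_)
  rintro _ ⟨i, rfl⟩
  exact congrFun h i

theorem preimage_zeros (hN : 0 < N) {q : ℕ} {t : Fin q → traceRing rels N}
    (ht : Algebra.adjoin k (Set.range t) = ⊤) (I : TwoSidedIdeal (Alg rels)) :
    coordMap rels hirr hdvd t ⁻¹' zeros {f | MvPolynomial.aeval t f ∈ contraction rels N I} =
      primHull I := by
  ext P
  have hP : P ∈ primHull I ↔ _ := (contraction_le_iff hirr hdvd hN I P).symm
  rw [hP]
  constructor
  · intro h x hx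
    have : x ∈ (MvPolynomial.aeval t : MvPolynomial (Fin q) k →ₐ[k] _).range := by
      rw [← Algebra.adjoin_range_eq_range_aeval, ht]
      exact Algebra.mem_top
    obtain ⟨f, rfl⟩ := this
    have h1 := h f hx
    rw [eval_coordMap] at h1
    exact h1
  · intro h f hf
    rw [eval_coordMap]
    exact h hf

theorem isClosedMap_coordMap (hN : 0 < N) {q : ℕ} {t : Fin q → traceRing rels N}
    (ht : Algebra.adjoin k (Set.range t) = ⊤) :
    IsClosedMap (Set.rangeFactorization (coordMap rels hirr hdvd t)) := by
  intro Z hZ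
  obtain ⟨I, rfl⟩ := isClosed_prim_iff.1 hZ
  rw [← preimage_zeros hirr hdvd hN ht, rangeFactorization_image_preimage]
  exact (isClosed_zeros _).preimage continuous_subtype_val

end Psi

/-! ### Chevalley's theorem for the points of an affine space -/

section Chevalley

open Topology

variable {k : Type u} [Field k]

/-- A point of `k^q`, seen as a closed point of the spectrum of the polynomial ring. -/
noncomputable def toSpec {q : ℕ} (y : AffineSpc k q) :
    PrimeSpectrum (MvPolynomial (Fin q) k) :=
  MvPolynomial.pointToPoint (k := k) (K := k) y

theorem mem_pointToPoint {τ : Type*} (x : τ → k) (f : MvPolynomial τ k) :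
    f ∈ (MvPolynomial.pointToPoint (k := k) x).asIdeal ↔ MvPolynomial.aeval x f = 0 :=
  MvPolynomial.mem_vanishingIdeal_singleton_iff x f

theorem preimage_toSpec_zeroLocus {q : ℕ} (S : Set (MvPolynomial (Fin q) k)) :
    toSpec ⁻¹' PrimeSpectrum.zeroLocus S = zeros S := by
  ext y
  constructor
  · intro h f hf
    exact (mem_pointToPoint (y : Fin q → k) f).1 (h hf)
  · intro h f hf
    exact (mem_pointToPoint (y : Fin q → k) f).2 (h f hf)

theorem isInducing_toSpec (q : ℕ) : IsInducing (toSpec : AffineSpc k q → _) := by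
  refine ⟨TopologicalSpace.ext_isClosed fun Z => ?_⟩
  rw [isClosed_induced_iff]
  constructor
  · intro h
    have h' : Zᶜᶜ ∈ Set.range zeros := isOpen_compl_iff.2 h
    rw [compl_compl] at h'
    obtain ⟨S, rfl⟩ := h'
    exact ⟨_, PrimeSpectrum.isClosed_zeroLocus S, preimage_toSpec_zeroLocus S⟩
  · rintro ⟨W, hW, rfl⟩
    obtain ⟨S, rfl⟩ := (PrimeSpectrum.isClosed_iff_zeroLocus W).1 hW
    rw [preimage_toSpec_zeroLocus]
    exact isClosed_zeros S

theorem isConstructible_preimage_toSpec {q : ℕ} {Z : Set (PrimeSpectrum (MvPolynomial (Fin q) k))}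
    (hZ : IsConstructible Z) : IsConstructible (toSpec ⁻¹' Z) := by
  have := (isInducing_toSpec (k := k) q).noetherianSpace
  exact hZ.preimage (isInducing_toSpec q).continuous fun _ _ _ U _ _ =>
    TopologicalSpace.NoetherianSpace.isCompact _

theorem comap_pointToPoint {τ : Type*} {q : ℕ} (F : Fin q → MvPolynomial τ k) (x : τ → k) :
    PrimeSpectrum.comap (MvPolynomial.aeval F : MvPolynomial (Fin q) k →ₐ[k] _).toRingHom
      (MvPolynomial.pointToPoint x) = toSpec fun i => MvPolynomial.aeval x (F i) := by
  refine PrimeSpectrum.ext (Ideal.ext fun f => ?_)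
  have h : (MvPolynomial.aeval fun i => MvPolynomial.aeval x (F i)) =
      (MvPolynomial.aeval x : MvPolynomial τ k →ₐ[k] k).comp (MvPolynomial.aeval F) := by
    refine MvPolynomial.algHom_ext fun i => ?_
    rw [MvPolynomial.aeval_X, AlgHom.comp_apply, MvPolynomial.aeval_X]
  refine (mem_pointToPoint x _).trans (Iff.trans ?_ (mem_pointToPoint _ f).symm)
  rw [h]
  rfl

theorem pointToPoint_injective {τ : Type*} :
    Function.Injective (MvPolynomial.pointToPoint (k := k) : (τ → k) → _) := by
  intro y z h
  funext i
  have h1 : MvPolynomial.X i - MvPolynomial.C (z i) ∈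
      (MvPolynomial.pointToPoint (k := k) z).asIdeal :=
    (mem_pointToPoint z _).2 (by simp)
  rw [← h, mem_pointToPoint, map_sub, MvPolynomial.aeval_X, MvPolynomial.aeval_C] at h1
  exact sub_eq_zero.1 h1

/-- **Chevalley's theorem** for points over an algebraically closed field: the image under a
polynomial map of the intersection of a closed set, defined by `I`, and an open set, defined by
`D`, is constructible. A nonempty fibre of the map between the spectra, intersected with the
locally closed set, contains a closed point, which by the Nullstellensatz is a point over `k`. -/
theorem isConstructible_image [IsAlgClosed k] {τ : Type*} [Finite τ] {q : ℕ}
    (I D : Set (MvPolynomial τ k)) (F : Fin q → MvPolynomial τ k) :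
    IsConstructible {y : AffineSpc k q | ∃ x : τ → k, (∀ p ∈ I, MvPolynomial.aeval x p = 0) ∧
      (∃ p ∈ D, MvPolynomial.aeval x p ≠ 0) ∧ y = fun i => MvPolynomial.aeval x (F i)} := by
  let φ : MvPolynomial (Fin q) k →+* MvPolynomial τ k :=
    (MvPolynomial.aeval F : MvPolynomial (Fin q) k →ₐ[k] _).toRingHom
  have hφ : φ.FinitePresentation := by
    refine RingHom.FinitePresentation.of_finiteType.1
      (RingHom.FiniteType.of_comp_finiteType (f := algebraMap k (MvPolynomial (Fin q) k)) ?_)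
    have h : φ.comp (algebraMap k (MvPolynomial (Fin q) k)) = algebraMap k (MvPolynomial τ k) :=
      (MvPolynomial.aeval F : MvPolynomial (Fin q) k →ₐ[k] MvPolynomial τ k).comp_algebraMap
    rw [h, RingHom.finiteType_algebraMap]
    infer_instance
  let Z : Set (PrimeSpectrum (MvPolynomial τ k)) :=
    PrimeSpectrum.zeroLocus I ∩ (PrimeSpectrum.zeroLocus D)ᶜ
  have hcl : IsClosed (PrimeSpectrum.zeroLocus I) := PrimeSpectrum.isClosed_zeroLocus I
  have hop : IsOpen (PrimeSpectrum.zeroLocus D)ᶜ :=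
    (PrimeSpectrum.isClosed_zeroLocus D).isOpen_compl
  have hcomp : ∀ W : Set (PrimeSpectrum (MvPolynomial τ k)), IsCompact W :=
    fun W => TopologicalSpace.NoetherianSpace.isCompact W
  have hZ : IsConstructible Z := by
    refine IsConstructible.inter ?_ ((hcomp _).isConstructible hop)
    rw [← isConstructible_compl]
    exact (hcomp _).isConstructible hcl.isOpen_compl
  have hmemZ : ∀ x : τ → k, MvPolynomial.pointToPoint x ∈ Z ↔
      (∀ p ∈ I, MvPolynomial.aeval x p = 0) ∧ ∃ p ∈ D, MvPolynomial.aeval x p ≠ 0 := by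
    intro x
    refine and_congr (forall₂_congr fun p _ => mem_pointToPoint x p) ?_
    rw [Set.mem_compl_iff, PrimeSpectrum.mem_zeroLocus, Set.not_subset]
    exact exists_congr fun p => and_congr_right fun _ => not_congr (mem_pointToPoint x p)
  have hmain := isConstructible_preimage_toSpec
    (PrimeSpectrum.isConstructible_comap_image hφ hZ)
  convert hmain using 1
  ext y
  constructor
  · rintro ⟨x, h1, h2, rfl⟩
    exact ⟨MvPolynomial.pointToPoint x, (hmemZ x).2 ⟨h1, h2⟩, comap_pointToPoint F x⟩
  · rintro ⟨𝔭, h𝔭, hy⟩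
    have hpt : IsClosed {toSpec y} := by
      rw [PrimeSpectrum.isClosed_singleton_iff_isMaximal]
      exact MvPolynomial.isMaximal_iff_eq_vanishingIdeal_singleton.2 ⟨y, rfl⟩
    have hloc : IsLocallyClosed (Z ∩ PrimeSpectrum.comap φ ⁻¹' {toSpec y}) :=
      (hcl.isLocallyClosed.inter hop.isLocallyClosed).inter
        (hpt.preimage (PrimeSpectrum.continuous_comap φ)).isLocallyClosed
    have hne : (Z ∩ PrimeSpectrum.comap φ ⁻¹' {toSpec y}).Nonempty := ⟨𝔭, h𝔭, hy⟩
    obtain ⟨𝔪, ⟨h𝔪, hy𝔪⟩, hmax⟩ := nonempty_inter_closedPoints hne hloc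
    rw [mem_closedPoints_iff, PrimeSpectrum.isClosed_singleton_iff_isMaximal] at hmax
    obtain ⟨x, hx⟩ := MvPolynomial.isMaximal_iff_eq_vanishingIdeal_singleton.1 hmax
    obtain rfl : 𝔪 = MvPolynomial.pointToPoint x := PrimeSpectrum.ext hx
    obtain ⟨h1, h2⟩ := (hmemZ x).1 h𝔪
    refine ⟨x, h1, h2, pointToPoint_injective (k := k) ?_⟩
    exact (hy𝔪.symm).trans (comap_pointToPoint F x)

end Chevalley

/-! ### The image in affine space -/

section Image

variable {k : Type u} [Field k]

theorem isIrreducibleRep_of_surjective {R : Type u} [Ring R] [Algebra k R] {m : ℕ} (hm : 0 < m)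
    {ρ : R →ₐ[k] Matrix (Fin m) (Fin m) k} (h : Function.Surjective ρ) : IsIrreducibleRep ρ := by
  refine ⟨hm, fun W hW => or_iff_not_imp_left.2 fun hW0 => eq_top_iff.2 fun v _ => ?_⟩
  obtain ⟨w, hw, hw0⟩ := Submodule.exists_mem_ne_zero_of_ne_bot hW0
  obtain ⟨j, hj⟩ := Function.ne_iff.1 hw0
  obtain ⟨r, hr⟩ := h (Matrix.vecMulVec v (Pi.single j (w j)⁻¹))
  have h1 := hW r w hw
  rw [hr, Matrix.vecMulVec_mulVec, single_dotProduct, inv_mul_cancel₀ hj] at h1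
  simpa using h1

theorem isPrimitiveIdeal_ker {R : Type u} [Ring R] [Algebra k R] {m : ℕ}
    {ρ : R →ₐ[k] Matrix (Fin m) (Fin m) k} (h : IsIrreducibleRep ρ) :
    IsPrimitiveIdeal (TwoSidedIdeal.ker ρ) := by
  let φ : R →+* Module.End k (Fin m → k) :=
    ((Matrix.toLinAlgEquiv' : Matrix (Fin m) (Fin m) k ≃ₐ[k] _).toAlgHom.comp ρ).toRingHom
  let instV : Module R (Fin m → k) := Module.compHom _ φ
  have hsmul : ∀ (r : R) (v : Fin m → k), r • v = (ρ r).mulVec v := fun r v => rfl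
  have : NeZero m := ⟨h.1.ne'⟩
  refine ⟨Fin m → k, inferInstance, instV, { eq_bot_or_eq_top := fun W => ?_ }, fun r => ?_⟩
  · let W' : Submodule k (Fin m → k) :=
      { W.toAddSubmonoid with
        smul_mem' := fun c v hv => by
          have h1 := W.smul_mem (algebraMap k R c) hv
          rw [hsmul, AlgHom.commutes, Algebra.algebraMap_eq_smul_one, Matrix.smul_mulVec,
            Matrix.one_mulVec] at h1
          exact h1 }
    have hmem : ∀ v, v ∈ W' ↔ v ∈ W := fun v => Iff.rfl
    rcases h.2 W' fun r w hw => W.smul_mem r hw with h0 | h0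
    · refine Or.inl ((Submodule.eq_bot_iff W).2 fun v hv => ?_)
      rwa [← hmem, h0] at hv
    · refine Or.inr (eq_top_iff.2 fun v _ => ?_)
      rw [← hmem, h0]
      trivial
  · rw [TwoSidedIdeal.mem_ker]
    constructor
    · intro h0 v
      rw [hsmul, h0, Matrix.zero_mulVec]
    · intro h0
      refine Matrix.ext_of_mulVec_single fun i => ?_
      rw [← hsmul, h0, Matrix.zero_mulVec]

variable {s : ℕ} {rels : Set (FreeAlgebra k (Fin s))}

/-- The determinants of the families of `m ^ 2` elements of the algebra of generic matrices. A
representation of dimension `m` is irreducible exactly if one of them does not vanish at it. -/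
def spanDets (k : Type u) [Field k] (s m : ℕ) :
    Set (MvPolynomial (Fin s × Fin m × Fin m) k) :=
  Set.range fun w : Fin m × Fin m → FreeAlgebra k (Fin s) =>
    (Matrix.of fun p q : Fin m × Fin m => piHat k s m (w p) q.1 q.2).det

/-- The entries of the matrices by which a representation represents the generators. -/
noncomputable def repPoint {m : ℕ}
    (ρ : Alg rels →ₐ[k] Matrix (Fin m) (Fin m) k) : Fin s × Fin m × Fin m → k :=
  fun p => ρ (proj rels (FreeAlgebra.ι k p.1)) p.2.1 p.2.2

theorem aeval_repPoint {m : ℕ} (ρ : Alg rels →ₐ[k] Matrix (Fin m) (Fin m) k)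
    (f : MvPolynomial (Fin s × Fin m × Fin m) k) :
    MvPolynomial.aeval (repPoint ρ) f = tildeC ρ (Ideal.Quotient.mk _ f) := rfl

theorem exists_repPoint_eq {m : ℕ} {x : Fin s × Fin m × Fin m → k}
    (hx : ∀ p ∈ relIdeal rels m, MvPolynomial.aeval x p = 0) :
    ∃ ρ : Alg rels →ₐ[k] Matrix (Fin m) (Fin m) k, repPoint ρ = x := by
  let χ : CRing rels m →ₐ[k] k := Ideal.Quotient.liftₐ (relIdeal rels m) (MvPolynomial.aeval x) hx
  refine ⟨χ.mapMatrix.comp (piHom rels m), funext fun ⟨l, i, j⟩ => ?_⟩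
  have h : piHom rels m (proj rels (FreeAlgebra.ι k l)) i j =
      Ideal.Quotient.mk _ (MvPolynomial.X (l, i, j)) := by
    rw [piHom, proj, RingQuot.liftAlgHom_mkAlgHom_apply]
    simp [piHat, genericMatrix]
  change χ (piHom rels m (proj rels (FreeAlgebra.ι k l)) i j) = _
  rw [h]
  exact MvPolynomial.aeval_X x (l, i, j)

theorem exists_spanDets_ne_zero_iff {m : ℕ} (ρ : Alg rels →ₐ[k] Matrix (Fin m) (Fin m) k) :
    (∃ p ∈ spanDets k s m, MvPolynomial.aeval (repPoint ρ) p ≠ 0) ↔ Function.Surjective ρ := by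
  have hdet : ∀ w : Fin m × Fin m → FreeAlgebra k (Fin s),
      MvPolynomial.aeval (repPoint ρ)
        (Matrix.of fun p q : Fin m × Fin m => piHat k s m (w p) q.1 q.2).det =
          (Matrix.of fun p q : Fin m × Fin m => ρ (proj rels (w p)) q.1 q.2).det := by
    intro w
    rw [AlgHom.map_det]
    congr 1
    ext p q
    exact congrFun (congrFun (eval_piHat ρ (w p)) q.1) q.2
  constructor
  · rintro ⟨_, ⟨w, rfl⟩, hw⟩ M
    rw [hdet] at hw
    set G := Matrix.of fun p q : Fin m × Fin m => ρ (proj rels (w p)) q.1 q.2 with hG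
    let c := Matrix.vecMul (fun q : Fin m × Fin m => M q.1 q.2) G⁻¹
    refine ⟨∑ p, c p • proj rels (w p), ?_⟩
    have hc : Matrix.vecMul c G = fun q => M q.1 q.2 := by
      rw [Matrix.vecMul_vecMul, Matrix.nonsing_inv_mul _ (isUnit_iff_ne_zero.2 hw),
        Matrix.vecMul_one]
    ext i j
    rw [← congrFun hc (i, j), map_sum, Matrix.sum_apply]
    simp [Matrix.vecMul, dotProduct, hG]
  · intro h
    have : ∀ p : Fin m × Fin m, ∃ f, ρ (proj rels f) = Matrix.single p.1 p.2 1 := by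
      intro p
      obtain ⟨r, hr⟩ := h (Matrix.single p.1 p.2 1)
      obtain ⟨f, rfl⟩ := RingQuot.mkAlgHom_surjective k _ r
      exact ⟨f, hr⟩
    choose w hw using this
    refine ⟨_, ⟨w, rfl⟩, ?_⟩
    rw [hdet]
    have h1 : (Matrix.of fun p q : Fin m × Fin m => ρ (proj rels (w p)) q.1 q.2) = 1 := by
      ext p q
      rw [Matrix.of_apply, hw, Matrix.single_apply, Matrix.one_apply]
      simp only [Prod.ext_iff]
    rw [h1, Matrix.det_one]
    exact one_ne_zero

/-- The substitution that replaces the generic `N × N` matrices by block diagonal matrices with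
equal diagonal blocks, the generic `m × m` matrices. -/
noncomputable def diagSubst (k : Type u) [Field k] (s N : ℕ) {m : ℕ} (hm : 0 < m) :
    MvPolynomial (Fin s × Fin N × Fin N) k →ₐ[k] MvPolynomial (Fin s × Fin m × Fin m) k :=
  MvPolynomial.aeval fun p => if (p.2.1 : ℕ) / m = (p.2.2 : ℕ) / m then
    MvPolynomial.X (p.1, ⟨p.2.1 % m, Nat.mod_lt _ hm⟩, ⟨p.2.2 % m, Nat.mod_lt _ hm⟩) else 0

theorem tildeC_diagRep {m N : ℕ} (hm : 0 < m) (hmN : m ∣ N)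
    (ρ : Alg rels →ₐ[k] Matrix (Fin m) (Fin m) k) (f : MvPolynomial (Fin s × Fin N × Fin N) k) :
    tildeC (diagRep hmN ρ) (Ideal.Quotient.mk _ f) =
      MvPolynomial.aeval (repPoint ρ) (diagSubst k s N hm f) := by
  rw [← aeval_repPoint, ← AlgHom.comp_apply]
  congr 1
  refine MvPolynomial.algHom_ext fun p => ?_
  rw [MvPolynomial.aeval_X, AlgHom.comp_apply, diagSubst, MvPolynomial.aeval_X, repPoint,
    diagRep_apply hmN hm]
  split_ifs
  · rw [MvPolynomial.aeval_X]
    rfl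
  · rw [map_zero]

variable {d N : ℕ} (hirr : IrrepDimLE k (Alg rels) d) (hdvd : ∀ m, 1 ≤ m → m ≤ d → m ∣ N)

/-- The image of the primitive ideals in `k^q` is constructible: it is the union, over `m ≤ d`, of
the images of the varieties of irreducible representations of dimension `m`. -/
theorem isConstructible_range_coordMap [IsAlgClosed k] {q : ℕ} (t : Fin q → traceRing rels N) :
    Topology.IsConstructible (Set.range (coordMap rels hirr hdvd t)) := by
  choose f hf using fun i => Ideal.Quotient.mk_surjective (t i : CRing rels N)
  have hcoord : ∀ {m : ℕ} (hm : 0 < m) (hmN : m ∣ N)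
      (ρ : Alg rels →ₐ[k] Matrix (Fin m) (Fin m) k) (P : Prim (Alg rels)), IsIrreducibleRep ρ →
      TwoSidedIdeal.ker ρ = P.ideal → coordMap rels hirr hdvd t P =
        fun i => MvPolynomial.aeval (repPoint ρ) (diagSubst k s N hm (f i)) := by
    intro m hm hmN ρ P hρ hP
    funext i
    rw [← tildeC_diagRep hm hmN, hf]
    exact congrArg (fun g : traceRing rels N →ₐ[k] k => g (t i))
      (gammaN_eq hirr hdvd P hmN hρ hP)
  have hrange : Set.range (coordMap rels hirr hdvd t) =
      ⋃ m : {m : Fin (d + 1) // 0 < (m : ℕ)}, {y : AffineSpc k q |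
        ∃ x : Fin s × Fin m.1 × Fin m.1 → k,
          (∀ p ∈ (relIdeal rels m.1 : Set (MvPolynomial (Fin s × Fin m.1 × Fin m.1) k)),
            MvPolynomial.aeval x p = 0) ∧
          (∃ p ∈ spanDets k s m.1, MvPolynomial.aeval x p ≠ 0) ∧
          y = fun i => MvPolynomial.aeval x (diagSubst k s N m.2 (f i))} := by
    ext y
    rw [Set.mem_iUnion]
    constructor
    · rintro ⟨P, rfl⟩
      obtain ⟨m, ρ, ⟨hm1, hmd⟩, hρ, hP⟩ := exists_irreducibleRep hirr P
      refine ⟨⟨⟨m, Nat.lt_succ_of_le hmd⟩, hm1⟩, repPoint ρ, fun p hp => ?_,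
        (exists_spanDets_ne_zero_iff ρ).2 hρ.surjective,
        hcoord hm1 (hdvd m hm1 hmd) ρ P hρ hP⟩
      rw [aeval_repPoint, Ideal.Quotient.eq_zero_iff_mem.2 hp, map_zero]
    · rintro ⟨⟨m, hm⟩, x, hx, hdet, rfl⟩
      obtain ⟨ρ, rfl⟩ := exists_repPoint_eq hx
      have hρ := isIrreducibleRep_of_surjective hm ((exists_spanDets_ne_zero_iff ρ).1 hdet)
      exact ⟨⟨_, isPrimitiveIdeal_ker hρ⟩, hcoord hm (hdvd m hm (Nat.le_of_lt_succ m.2)) ρ _ hρ rfl⟩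
  rw [hrange]
  exact Topology.IsConstructible.iUnion fun m => isConstructible_image _ _ _

end Image

end AffinePI

theorem proposition4p2 {k : Type*} [Field k] [IsAlgClosed k] {s : ℕ}
    (rels : Set (FreeAlgebra k (Fin s)))
    (hPI : SatisfiesPI k (Alg rels))
    (d N : ℕ) (hd : 0 < d) (hirr : IrrepDimLE k (Alg rels) d)
    (hN : 0 < N) (hdvd : ∀ m, 1 ≤ m → m ≤ d → m ∣ N) :
    -- `Ψ(P)` does not depend on the choice of the irreducible representation with kernel `P`
    (∀ (P : Prim (Alg rels)) (m : ℕ) (hm : m ∣ N)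
        (ρ : Alg rels →ₐ[k] Matrix (Fin m) (Fin m) k),
        IsIrreducibleRep ρ → TwoSidedIdeal.ker ρ = P.ideal →
          (Psi rels hirr hdvd P).asIdeal = RingHom.ker (tildeT (diagRep hm ρ))) ∧
    Function.Injective (Psi rels hirr hdvd) ∧
    -- `Ψ` is open and closed onto its image
    IsOpenMap (Set.rangeFactorization (Psi rels hirr hdvd)) ∧
    IsClosedMap (Set.rangeFactorization (Psi rels hirr hdvd)) ∧
    (∀ I : TwoSidedIdeal (Alg rels),
      Psi rels hirr hdvd '' primHull I =
          Set.range (Psi rels hirr hdvd) ∩ maxHull (contraction rels N I) ∧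
      Psi rels hirr hdvd '' (primHull I)ᶜ =
          Set.range (Psi rels hirr hdvd) ∩ (maxHull (contraction rels N I))ᶜ) ∧
    -- the resulting closed bijection onto a constructible subset of an affine space
    Algebra.FiniteType k (traceRing rels N) ∧
    (∀ (q : ℕ) (t : Fin q → traceRing rels N), Algebra.adjoin k (Set.range t) = ⊤ →
      Function.Injective (coordMap rels hirr hdvd t) ∧
      IsClosedMap (Set.rangeFactorization (coordMap rels hirr hdvd t)) ∧
      Topology.IsConstructible (Set.range (coordMap rels hirr hdvd t))) := by
  refine ⟨fun P m hm ρ hρ hP => ?_, Psi_injective hirr hdvd hN, isOpenMap_Psi hirr hdvd hN,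
    isClosedMap_Psi hirr hdvd hN, fun I => ⟨?_, ?_⟩, (traceRing rels N).fg_iff_finiteType.1
      traceRing_fg, fun q t ht => ⟨coordMap_injective hirr hdvd hN ht,
        isClosedMap_coordMap hirr hdvd hN ht, isConstructible_range_coordMap hirr hdvd t⟩⟩
  · rw [← gammaN_eq hirr hdvd P hm hρ hP]
    rfl
  · rw [← preimage_maxHull hirr hdvd hN, Set.image_preimage_eq_range_inter]
  · rw [← preimage_maxHull hirr hdvd hN, ← Set.preimage_compl, Set.image_preimage_eq_range_inter]
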